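/- Let $r,d\ge 1$ be integers. For a complex vector space $V$ of dimension $r$ with a Hermitian inner product $h$ (all Hermitian pairings are linear in the first and conjugate linear in the second argument), let $\mathrm{Sym}^dV$ be the quotient of $V^{\otimes d}$ by permutation of the factors, and let $\mathrm{Sym}^dh$ be the Hermitian inner product on it with $$\langle v_1\cdots v_d,\,w_1\cdots w_d\rangle_{\mathrm{Sym}^dh}=\frac1{d!}\sum_{\sigma\in S_d}\prod_{i=1}^d\langle v_i,w_{\sigma(i)}\rangle_h .$$ For $f\in V^*$ let $f^{\otimes d}\in(\mathrm{Sym}^dV)^*$ be the functional $v_1\cdots v_d\mapsto f(v_1)\cdots f(v_d)$. For a Hermitian inner product $H$ on $\mathrm{Sym}^dV$ and $v,w\in\mathrm{Sym}^dV$, define the function $$\langle\hat v,\hat w\rangle_{\hat H}([f])=\frac{f^{\otimes d}(v)\,\overline{f^{\otimes d}(w)}}{|f^{\otimes d}|_{H}^2}\qquad([f]\in\mathbb PV^*),$$ where $|\cdot|_H$ in the denominator is the norm on $(\mathrm{Sym}^dV)^*$ dual to $|\cdot|_H$. Let $\hat h$ be the metric on $\mathcal O_{\mathbb PV^*}(1)$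 with $\langle\hat v,\hat w\rangle_{\hat h}([f])=f(v)\overline{f(w)}/|f|_h^2$ for $v,w\in V$ (again with the dual norm on $V^*$), and let $\omega_{FS,h}=i\bar\partial\partial\log\hat h$ be the associated Fubini–Study form on $\mathbb PV^*$. Finally let $$\|H-\mathrm{Sym}^dh\|=\sup\{|\langle v,w\rangle_H-\langle v,w\rangle_{\mathrm{Sym}^dh}|:\ |v|_{\mathrm{Sym}^dh}\le1,\ |w|_{\mathrm{Sym}^dh}\le1\}.$$ Then there are real constants $C_{r,d}$ and $C$, depending only on $r$ and $d$, such that for every such $V$ and $h$ the following hold (all the integrals converging absolutely). 1. The constant $C_{r,d}$ is the one determined by the identity $$d^{r-1}\int_{\mathbb PV^*}\langle\hat v,\hat w\rangle_{\widehat{\mathrm{Sym}^dh}}\,\frac{\omega_{FS,h}^{r-1}}{(r-1)!}=C_{r,d}\,\langle v,w\rangle_{\mathrm{Sym}^dh}\qquad\text{for all }v,w\in\mathrm{Sym}^dV.$$ 2. If $H$ is a Hermitian inner product on $\mathrm{Sym}^dV$ and $\varepsilon$ is a real number with $\|H-\mathrm{Sym}^dh\|<\min(\varepsilon,\tfrac12)$,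 then for all $v,w\in\mathrm{Sym}^dV$ $$\Big|d^{r-1}\int_{\mathbb PV^*}\langle\hat v,\hat w\rangle_{\hat H}\,\frac{\omega_{FS,h}^{r-1}}{(r-1)!}-C_{r,d}\,\langle v,w\rangle_H\Big|\le C\,\varepsilon\,|v|_H\,|w|_H .$$ -/

import Mathlib

open scoped ComplexConjugate LinearAlgebra.Projectivization
open MeasureTheory

noncomputable section

/-! ### Hermitian inner products

A Hermitian inner product on a complex vector space `W` is a term of
`InnerProductSpace.Core ℂ W`. Mathlib's `inner` is conjugate linear in the first slot; the pairing
`herm H` below is the usual one of complex geometry, linear in the first slot. -/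

section Hermitian

variable {W : Type*} [AddCommGroup W] [Module ℂ W]

/-- The pairing `⟨v, w⟩_H`, linear in `v` and conjugate linear in `w`. -/
def herm (H : InnerProductSpace.Core ℂ W) (v w : W) : ℂ := H.inner w v

/-- The norm `|v|_H = √⟨v, v⟩_H`. -/
def hermNorm (H : InnerProductSpace.Core ℂ W) (v : W) : ℝ := Real.sqrt (herm H v v).re

/-- The norm `‖H - S‖_S` of the Hermitian form `H - S`, measured with respect to `S`:
the supremum of `|⟨v, w⟩_H - ⟨v, w⟩_S|` over the `v`, `w` in the unit ball of `S`. -/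
def hermDist (H S : InnerProductSpace.Core ℂ W) : ℝ :=
  sSup {x : ℝ | ∃ v w : W, hermNorm S v ≤ 1 ∧ hermNorm S w ≤ 1 ∧ x = ‖herm H v w - herm S v w‖}

/-- The norm on the dual space `W*` that is dual to the norm of `H`. -/
def dualNorm (H : InnerProductSpace.Core ℂ W) (φ : Module.Dual ℂ W) : ℝ :=
  sSup {x : ℝ | ∃ w : W, hermNorm H w ≤ 1 ∧ x = ‖φ w‖}

theorem dualNorm_smul (H : InnerProductSpace.Core ℂ W) (c : ℂ) (φ : Module.Dual ℂ W) :
    dualNorm H (c • φ) = ‖c‖ * dualNorm H φ := by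
  open scoped Pointwise in
  have : {x : ℝ | ∃ w : W, hermNorm H w ≤ 1 ∧ x = ‖(c • φ) w‖}
      = ‖c‖ • {x : ℝ | ∃ w : W, hermNorm H w ≤ 1 ∧ x = ‖φ w‖} := by
    ext x
    simp only [Set.mem_ofPred_eq, Set.mem_smul_set]
    constructor
    · rintro ⟨w, hw, rfl⟩
      exact ⟨_, ⟨w, hw, rfl⟩, by simp⟩
    · rintro ⟨_, ⟨w, hw, rfl⟩, rfl⟩
      exact ⟨w, hw, by simp⟩
  rw [dualNorm, this, Real.sSup_smul_of_nonneg (norm_nonneg c)]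
  rfl

/-- `w ↦ inner v w`, as a linear functional. -/
def innerFunctional (H : InnerProductSpace.Core ℂ W) (v : W) : Module.Dual ℂ W where
  toFun w := H.inner v w
  map_add' x y := by
    rw [← H.conj_inner_symm, H.add_left, map_add, H.conj_inner_symm, H.conj_inner_symm]
  map_smul' c x := by
    rw [← H.conj_inner_symm, H.smul_left, map_mul, H.conj_inner_symm]; simp

end Hermitian

/-! ### The symmetric power `Sym^d V` and the inner product `Sym^d h` -/

/-- `Sym^d V`, the quotient of `V^{⊗d}` by permutation of the factors. -/
abbrev SymPow (d : ℕ) (V : Type*) [AddCommGroup V] [Module ℂ V] := SymmetricPower ℂ (Fin d) V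

section Sym

variable {V : Type*} [AddCommGroup V] [Module ℂ V] {d : ℕ}

/-- The class `v₁ ⋯ v_d` of `v₁ ⊗ ⋯ ⊗ v_d` in `Sym^d V`. -/
abbrev symMk (v : Fin d → V) : SymPow d V := SymmetricPower.tprod ℂ v

/-- A symmetric multilinear map factors through `Sym^d V`. -/
def symLift {N : Type*} [AddCommGroup N] [Module ℂ N]
    (f : MultilinearMap ℂ (fun _ : Fin d => V) N)
    (hf : ∀ (e : Equiv.Perm (Fin d)) (v : Fin d → V), f (fun i => v (e i)) = f v) :
    SymPow d V →ₗ[ℂ] N where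
  toFun := AddCon.lift (addConGen (SymmetricPower.Rel ℂ (Fin d) V))
    (PiTensorProduct.lift f).toAddMonoidHom (AddCon.addConGen_le.2 (by
      rintro _ _ ⟨e, v⟩
      simp [AddCon.ker_rel, hf]))
  map_add' := map_add _
  map_smul' c x := by
    obtain ⟨y, rfl⟩ := LinearMap.range_eq_top.1 (SymmetricPower.range_mk ℂ (Fin d) V) x
    exact (PiTensorProduct.lift f).map_smul c y

theorem symLift_symMk {N : Type*} [AddCommGroup N] [Module ℂ N]
    (f : MultilinearMap ℂ (fun _ : Fin d => V) N)
    (hf : ∀ (e : Equiv.Perm (Fin d)) (v : Fin d → V), f (fun i => v (e i)) = f v)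
    (v : Fin d → V) : symLift f hf (symMk v) = f v :=
  PiTensorProduct.lift.tprod v

/-- Two (semi)linear maps on `Sym^d V` that agree on the products `v₁ ⋯ v_d` are equal. -/
theorem sym_ext {N : Type*} [AddCommGroup N] [Module ℂ N] {τ : ℂ →+* ℂ}
    {f g : SymPow d V →ₛₗ[τ] N} (hfg : ∀ v : Fin d → V, f (symMk v) = g (symMk v)) : f = g :=
  LinearMap.ext_on_range (SymmetricPower.span_tprod_eq_top ℂ (Fin d) V) hfg

/-- `f^{⊗d}` as a functional on `Sym^d V`: it sends `v₁ ⋯ v_d` to `f(v₁) ⋯ f(v_d)`. -/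
def powFunctional (d : ℕ) (f : Module.Dual ℂ V) : Module.Dual ℂ (SymPow d V) :=
  symLift ((MultilinearMap.mkPiAlgebra ℂ (Fin d) ℂ).compLinearMap fun _ => f) (by
    intro e v
    simpa using Equiv.prod_comp e (fun i => f (v i)))

theorem powFunctional_symMk (f : Module.Dual ℂ V) (v : Fin d → V) :
    powFunctional d f (symMk v) = ∏ i, f (v i) := by
  rw [powFunctional, symLift_symMk]; simp

theorem powFunctional_smul (c : ℂ) (f : Module.Dual ℂ V) :
    powFunctional d (c • f) = c ^ d • powFunctional d f := by
  apply sym_ext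
  intro v
  simp [powFunctional_symMk, Finset.prod_mul_distrib]

/-- The functional `v₁ ⋯ v_d ↦ (1/d!) ∑_σ ∏_i inner (w_{σ i}) (v_i)` on `Sym^d V`. -/
def symInnerAux (h : InnerProductSpace.Core ℂ V) (w : Fin d → V) : Module.Dual ℂ (SymPow d V) :=
  symLift (((d.factorial : ℂ)⁻¹) • ∑ σ : Equiv.Perm (Fin d),
      (MultilinearMap.mkPiAlgebra ℂ (Fin d) ℂ).compLinearMap
        fun i => innerFunctional h (w (σ i))) (by
    intro e v
    simp only [smul_apply, sum_apply,
      MultilinearMap.compLinearMap_apply, MultilinearMap.mkPiAlgebra_apply]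
    congr 1
    refine Fintype.sum_equiv (Equiv.mulRight e⁻¹) _ _ fun σ => ?_
    refine Fintype.prod_equiv e _ _ fun i => ?_
    simp)

theorem symInnerAux_symMk (h : InnerProductSpace.Core ℂ V) (w v : Fin d → V) :
    symInnerAux h w (symMk v)
      = (d.factorial : ℂ)⁻¹ * ∑ σ : Equiv.Perm (Fin d), ∏ i, h.inner (w (σ i)) (v i) := by
  rw [symInnerAux, symLift_symMk]
  simp [innerFunctional]

theorem symInnerAux_conj (h : InnerProductSpace.Core ℂ V) (v w : Fin d → V) :
    conj (symInnerAux h w (symMk v)) = symInnerAux h v (symMk w) := by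
  rw [symInnerAux_symMk, symInnerAux_symMk, map_mul, map_inv₀, map_natCast, map_sum]
  congr 1
  refine Fintype.sum_equiv (Equiv.inv _) _ _ fun σ => ?_
  rw [map_prod]
  refine Fintype.prod_equiv σ _ _ fun i => ?_
  rw [h.conj_inner_symm]
  simp

/-- The sesquilinear form `Sym^d h`, linear in the first and conjugate linear in the second
argument, with
`⟨v₁ ⋯ v_d, w₁ ⋯ w_d⟩ = (1/d!) ∑_σ ∏_i ⟨v_i, w_{σ i}⟩_h`; see `symForm_symMk`. -/
def symForm (d : ℕ) (h : InnerProductSpace.Core ℂ V) :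
    SymPow d V →ₗ[ℂ] SymPow d V →ₗ⋆[ℂ] ℂ :=
  symLift
    { toFun := fun v => (starLinearEquiv ℂ (A := ℂ)).toLinearMap.comp (symInnerAux h v)
      map_update_add' := by
        intro _ v i x y
        apply sym_ext
        intro u
        simp only [LinearMap.comp_apply, LinearMap.add_apply]
        change conj _ = conj _ + conj _
        rw [symInnerAux_conj, symInnerAux_conj, symInnerAux_conj, symMk,
          MultilinearMap.map_update_add, map_add]
      map_update_smul' := by
        intro _ v i c x
        apply sym_ext
        intro u
        simp only [LinearMap.comp_apply, LinearMap.smul_apply]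
        change conj _ = c • conj _
        rw [symInnerAux_conj, symInnerAux_conj, symMk, MultilinearMap.map_update_smul, map_smul] }
    (by
      intro e v
      apply sym_ext
      intro u
      change conj _ = conj _
      rw [symInnerAux_conj, symInnerAux_conj, symMk, SymmetricPower.tprod_equiv])

theorem symForm_symMk_left (h : InnerProductSpace.Core ℂ V) (v : Fin d → V) (t : SymPow d V) :
    symForm d h (symMk v) t = conj (symInnerAux h v t) := by
  rw [symForm, symLift_symMk]
  rfl

theorem symForm_symMk (h : InnerProductSpace.Core ℂ V) (v w : Fin d → V) :
    symForm d h (symMk v) (symMk w)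
      = (d.factorial : ℂ)⁻¹ * ∑ σ : Equiv.Perm (Fin d), ∏ i, herm h (v i) (w (σ i)) := by
  rw [symForm_symMk_left, symInnerAux_conj, symInnerAux_symMk]
  rfl

theorem symForm_symMk_right (h : InnerProductSpace.Core ℂ V) (s : SymPow d V) (w : Fin d → V) :
    symForm d h s (symMk w) = symInnerAux h w s := by
  have : (symForm d h).flip (symMk w) = symInnerAux h w := by
    apply sym_ext
    intro v
    rw [LinearMap.flip_apply, symForm_symMk_left, symInnerAux_conj]
  rw [← this, LinearMap.flip_apply]

theorem symForm_conj (h : InnerProductSpace.Core ℂ V) (s t : SymPow d V) :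
    conj (symForm d h t s) = symForm d h s t := by
  have : (starLinearEquiv ℂ (A := ℂ)).toLinearMap.comp ((symForm d h).flip s)
      = symForm d h s := by
    apply sym_ext
    intro w
    rw [LinearMap.comp_apply, LinearMap.flip_apply, symForm_symMk_left, symForm_symMk_right]
    exact Complex.conj_conj _
  rw [← this]
  rfl

theorem exists_orthonormal_expansion [FiniteDimensional ℂ V] (h : InnerProductSpace.Core ℂ V) :
    ∃ (n : ℕ) (e : Fin n → V), ∀ v : V, ∑ j, herm h v (e j) • e j = v := by
  let _ : NormedAddCommGroup V := h.toNormedAddCommGroup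
  let _ : InnerProductSpace ℂ V := InnerProductSpace.ofCore h.toCore
  exact ⟨_, stdOrthonormalBasis ℂ V, fun v => (stdOrthonormalBasis ℂ V).sum_repr' v⟩

theorem symForm_expansion (h : InnerProductSpace.Core ℂ V) {n : ℕ} {e : Fin n → V}
    (he : ∀ v : V, ∑ j, herm h v (e j) • e j = v) (s : SymPow d V) :
    ∑ p : Fin d → Fin n, symForm d h s (symMk fun k => e (p k)) • symMk (fun k => e (p k)) = s := by
  have key : ∑ p : Fin d → Fin n, ((symForm d h).flip (symMk fun k => e (p k))).smulRight
      (symMk fun k => e (p k)) = LinearMap.id := by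
    apply sym_ext
    intro v
    have hσ : ∀ σ : Equiv.Perm (Fin d), ∑ p : Fin d → Fin n,
        (∏ k, herm h (v k) (e (p (σ k)))) • symMk (fun k => e (p k)) = symMk v := by
      intro σ
      have h1 : symMk v = symMk fun m => v (σ⁻¹ m) := (SymmetricPower.tprod_equiv σ⁻¹ v).symm
      have h2 : (fun m => v (σ⁻¹ m)) = fun m => ∑ j, herm h (v (σ⁻¹ m)) (e j) • e j :=
        funext fun m => (he _).symm
      rw [h1, h2, symMk, MultilinearMap.map_sum]
      refine Finset.sum_congr rfl fun p _ => ?_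
      rw [MultilinearMap.map_smul_univ]
      congr 1
      exact Fintype.prod_equiv σ _ _ fun i => by simp
    simp only [LinearMap.sum_apply, LinearMap.smulRight_apply, LinearMap.flip_apply,
      symForm_symMk, LinearMap.id_apply, mul_smul, Finset.sum_smul]
    rw [← Finset.smul_sum, Finset.sum_comm, Finset.sum_congr rfl fun σ _ => hσ σ]
    have : (d.factorial : ℂ) ≠ 0 := by exact_mod_cast d.factorial_ne_zero
    simp [Fintype.card_perm, ← Nat.cast_smul_eq_nsmul ℂ, smul_smul, this]
  have := LinearMap.congr_fun key s
  simpa only [LinearMap.sum_apply, LinearMap.smulRight_apply, LinearMap.flip_apply,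
    LinearMap.id_apply] using this

theorem symForm_self (h : InnerProductSpace.Core ℂ V) {n : ℕ} {e : Fin n → V}
    (he : ∀ v : V, ∑ j, herm h v (e j) • e j = v) (s : SymPow d V) :
    symForm d h s s
      = ((∑ p : Fin d → Fin n, ‖symForm d h s (symMk fun k => e (p k))‖ ^ 2 : ℝ) : ℂ) := by
  have h1 := congrArg (symForm d h s) (symForm_expansion h he s)
  rw [← h1, map_sum]
  push_cast
  refine Finset.sum_congr rfl fun p _ => ?_
  rw [map_smulₛₗ, smul_eq_mul, Complex.conj_mul']

/-- `Sym^d h`, the Hermitian inner product induced by `h` on `Sym^d V`. -/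
@[reducible] def symInner (d : ℕ) [FiniteDimensional ℂ V] (h : InnerProductSpace.Core ℂ V) :
    InnerProductSpace.Core ℂ (SymPow d V) where
  inner s t := symForm d h t s
  conj_inner_symm s t := symForm_conj h t s
  re_inner_nonneg s := by
    obtain ⟨n, e, he⟩ := exists_orthonormal_expansion h
    change 0 ≤ (symForm d h s s).re
    rw [symForm_self h he, Complex.ofReal_re]
    positivity
  add_left s t u := by simp
  smul_left s t c := by simp
  definite s hs := by
    obtain ⟨n, e, he⟩ := exists_orthonormal_expansion h
    change symForm d h s s = 0 at hs
    rw [symForm_self h he, Complex.ofReal_eq_zero,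
      Finset.sum_eq_zero_iff_of_nonneg fun _ _ => by positivity] at hs
    rw [← symForm_expansion h he s]
    refine Finset.sum_eq_zero fun p hp => ?_
    have := hs p hp
    rw [sq_eq_zero_iff, norm_eq_zero] at this
    rw [this, zero_smul]

theorem herm_symInner_symMk [FiniteDimensional ℂ V] (h : InnerProductSpace.Core ℂ V)
    (v w : Fin d → V) :
    herm (symInner d h) (symMk v) (symMk w)
      = (d.factorial : ℂ)⁻¹ * ∑ σ : Equiv.Perm (Fin d), ∏ i, herm h (v i) (w (σ i)) :=
  symForm_symMk h v w

end Sym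

/-! ### The metrics on `O(1)` and `O(d)` over `ℙ V*` -/

section Metrics

variable {V : Type*} [AddCommGroup V] [Module ℂ V]

/-- The function `⟨v̂, ŵ⟩_ĥ` on `ℙ V*`, where `ĥ` is the metric on `O(1)` induced by `h`:
`⟨v̂, ŵ⟩_ĥ [f] = f(v) conj(f(w)) / |f|²`. -/
def hatOne (h : InnerProductSpace.Core ℂ V) (v w : V) : ℙ ℂ (Module.Dual ℂ V) → ℂ :=
  Projectivization.lift
    (fun f => f.1 v * conj (f.1 w) / ((dualNorm h f.1 : ℂ)) ^ 2) (by
      rintro ⟨f, hf⟩ ⟨g, hg⟩ t (rfl : f = t • g)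
      have ht : t ≠ 0 := by rintro rfl; simp at hf
      simp only [dualNorm_smul, LinearMap.smul_apply, smul_eq_mul, map_mul, Complex.ofReal_mul,
        mul_pow, ← Complex.mul_conj']
      have ht' : conj t ≠ 0 := by simpa using ht
      rw [← mul_div_mul_left (g v * conj (g w)) _ (mul_ne_zero ht ht')]
      ring)

/-- The function `⟨ŝ, t̂⟩_Ĥ` on `ℙ V*`, where `Ĥ` is the metric on `O(d)` induced by a Hermitian
inner product `H` on `Sym^d V`:
`⟨ŝ, t̂⟩_Ĥ [f] = f^{⊗d}(s) conj(f^{⊗d}(t)) / |f^{⊗d}|_H²`. -/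
def hatPow {d : ℕ} (H : InnerProductSpace.Core ℂ (SymPow d V)) (s t : SymPow d V) :
    ℙ ℂ (Module.Dual ℂ V) → ℂ :=
  Projectivization.lift
    (fun f => powFunctional d f.1 s * conj (powFunctional d f.1 t)
      / ((dualNorm H (powFunctional d f.1) : ℂ)) ^ 2) (by
      rintro ⟨f, hf⟩ ⟨g, hg⟩ c (rfl : f = c • g)
      have hc : c ≠ 0 := by rintro rfl; simp at hf
      have hcd : c ^ d ≠ 0 := pow_ne_zero d hc
      simp only [powFunctional_smul, dualNorm_smul, LinearMap.smul_apply, smul_eq_mul, map_mul,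
        Complex.ofReal_mul, mul_pow, ← Complex.mul_conj']
      have hc' : conj (c ^ d) ≠ 0 := by simpa using hcd
      rw [← mul_div_mul_left (powFunctional d g s * conj (powFunctional d g t)) _
        (mul_ne_zero hcd hc')]
      ring)

end Metrics

/-! ### Complex valued differential forms on a complex vector space -/

section Forms

variable {E : Type*} [NormedAddCommGroup E] [NormedSpace ℂ E]

/-- Multiplication by `i`, as a real linear map. -/
def mulI (E : Type*) [NormedAddCommGroup E] [NormedSpace ℂ E] : E →L[ℝ] E :=
  (Complex.I • ContinuousLinearMap.id ℂ E).restrictScalars ℝ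

/-- The `(1,0)`-form `∂φ`, with `∂φ(u) = (dφ(u) - i dφ(iu)) / 2`. -/
def del (φ : E → ℂ) (z : E) : E [⋀^Fin 1]→L[ℝ] ℂ :=
  ContinuousAlternatingMap.ofSubsingleton ℝ E ℂ (0 : Fin 1)
    ((1 / 2 : ℂ) • (fderiv ℝ φ z - Complex.I • (fderiv ℝ φ z).comp (mulI E)))

/-- The form `i ∂̄∂φ`. It is `i d(∂φ)`, as `d = ∂ + ∂̄` and `∂∂ = 0`. -/
def iDelbarDel (φ : E → ℂ) (z : E) : E [⋀^Fin 2]→L[ℝ] ℂ :=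
  Complex.I • extDeriv (del φ) z

/-- The exterior power `ω^n = ω ∧ ⋯ ∧ ω` of a `2`-form, with `n` the number of elements of `κ`,
evaluated at the `2n` vectors `v (k, 0), v (k, 1)` (in the order in which the pairs stand together):
`ω^n(v) = 2⁻ⁿ ∑_σ sign(σ) ∏_k ω(v_{σ(k,0)}, v_{σ(k,1)})`.
The normalization is the one with `(dx ∧ dy)(∂_x, ∂_y) = 1`. -/
def wedgePow {κ : Type*} [Fintype κ] [DecidableEq κ] (ω : E [⋀^Fin 2]→L[ℝ] ℂ)
    (v : κ × Fin 2 → E) : ℂ :=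
  (1 / 2 ^ Fintype.card κ : ℂ) * ∑ σ : Equiv.Perm (κ × Fin 2),
    ((Equiv.Perm.sign σ : ℤ) : ℂ) * ∏ k : κ, ω ![v (σ (k, 0)), v (σ (k, 1))]

/-- The oriented real basis `e_k, i e_k` of `ℂ^κ`; its dual volume form is the Lebesgue measure. -/
def orientedFrame (κ : Type*) [DecidableEq κ] (p : κ × Fin 2) : κ → ℂ :=
  Pi.single p.1 (if p.2 = 0 then 1 else Complex.I)

end Forms

/-! ### Integration over `ℙ V*` against `ω_FS^{r-1} / (r-1)!`

A basis `b` of `V` gives the homogeneous coordinates `f ↦ f(b i)` on `ℙ V*` and the affine charts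
`{f(b j) ≠ 0} ≅ ℂ^{r-1}`. The charts are cut down to the disjoint pieces
`{f(b j) ≠ 0, f(b i) = 0 for i < j}`, which cover `ℙ V*`, and the integral is the sum of the
integrals over these pieces. -/

section Integral

variable {V : Type*} [AddCommGroup V] [Module ℂ V] {r : ℕ}

/-- The functional with homogeneous coordinates `1` at `j` and `z i` at `i ≠ j`. -/
def chartFunctional (b : Module.Basis (Fin r) ℂ V) (j : Fin r) (z : {i : Fin r // i ≠ j} → ℂ) :
    Module.Dual ℂ V :=
  b.coord j + ∑ i : {i : Fin r // i ≠ j}, z i • b.coord i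

theorem chartFunctional_self (b : Module.Basis (Fin r) ℂ V) (j : Fin r)
    (z : {i : Fin r // i ≠ j} → ℂ) : chartFunctional b j z (b j) = 1 := by
  have : ∀ i : {i : Fin r // i ≠ j}, (b.repr (b j)) (i : Fin r) = 0 := fun i => by
    rw [b.repr_self, Finsupp.single_apply, if_neg (Ne.symm i.2)]
  simp only [chartFunctional, LinearMap.add_apply, LinearMap.sum_apply, LinearMap.smul_apply,
    Module.Basis.coord_apply, this, smul_zero, Finset.sum_const_zero, add_zero]
  simp

/-- The `j`-th affine chart `ℂ^{r-1} → ℙ V*`. -/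
def chart (b : Module.Basis (Fin r) ℂ V) (j : Fin r) (z : {i : Fin r // i ≠ j} → ℂ) :
    ℙ ℂ (Module.Dual ℂ V) :=
  Projectivization.mk ℂ (chartFunctional b j z) (by
    intro h0
    have := chartFunctional_self b j z
    simp [h0] at this)

/-- The part of the `j`-th chart in which the homogeneous coordinates before the `j`-th vanish. -/
def chartPiece (r : ℕ) (j : Fin r) : Set ({i : Fin r // i ≠ j} → ℂ) :=
  {z | ∀ i : {i : Fin r // i ≠ j}, (i : Fin r) < j → z i = 0}

/-- `log ĥ` in the `j`-th chart: the logarithm of the squared length of the holomorphic section of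
`O(1)` given by `b j`, which has no zero in that chart. -/
def logHat (h : InnerProductSpace.Core ℂ V) (b : Module.Basis (Fin r) ℂ V) (j : Fin r)
    (z : {i : Fin r // i ≠ j} → ℂ) : ℂ :=
  (Real.log (hatOne h (b j) (b j) (chart b j z)).re : ℂ)

/-- The Fubini-Study form `ω_{FS,h} = i ∂̄∂ log ĥ` in the `j`-th chart. -/
def fubiniStudy (h : InnerProductSpace.Core ℂ V) (b : Module.Basis (Fin r) ℂ V) (j : Fin r)
    (z : {i : Fin r // i ≠ j} → ℂ) : ({i : Fin r // i ≠ j} → ℂ) [⋀^Fin 2]→L[ℝ] ℂ :=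
  iDelbarDel (logHat h b j) z

/-- The coefficient of `F ω_{FS,h}^{r-1} / (r-1)!` with respect to the Lebesgue volume form of the
`j`-th chart (which has complex dimension `r - 1`). -/
def fsIntegrand (h : InnerProductSpace.Core ℂ V) (b : Module.Basis (Fin r) ℂ V)
    (F : ℙ ℂ (Module.Dual ℂ V) → ℂ) (j : Fin r) (z : {i : Fin r // i ≠ j} → ℂ) : ℂ :=
  F (chart b j z) *
    (wedgePow (fubiniStudy h b j z) (orientedFrame {i : Fin r // i ≠ j})
      / ((r - 1).factorial : ℂ))

/-- Integrability over `ℙ V*` of `F ω_{FS,h}^{r-1} / (r-1)!`. -/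
def FSIntegrable (h : InnerProductSpace.Core ℂ V) (b : Module.Basis (Fin r) ℂ V)
    (F : ℙ ℂ (Module.Dual ℂ V) → ℂ) : Prop :=
  ∀ j : Fin r, IntegrableOn (fsIntegrand h b F j) (chartPiece r j) volume

/-- The integral `∫_{ℙ V*} F ω_{FS,h}^{r-1} / (r-1)!`. -/
def fsIntegral (h : InnerProductSpace.Core ℂ V) (b : Module.Basis (Fin r) ℂ V)
    (F : ℙ ℂ (Module.Dual ℂ V) → ℂ) : ℂ :=
  ∑ j : Fin r, ∫ z in chartPiece r j, fsIntegrand h b F j z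

end Integral

end

noncomputable section

/-! Everything is computed in one affine chart, whose complement is null. Let `R` be the matrix of
an `h`-orthonormal basis `e` in the basis `b`. A functional with homogeneous coordinates `a` takes
the value `(a R)_k` on `e k`, so `|f|_h² = q(a) = |a R|²` and `log ĥ = -log q(1, z)`. At a point `x
= (1, z) R`, the Fubini–Study form is `1/q` times the Gram form of the components orthogonal to `x`.
Its top power is therefore a Gram determinant, and row operations give the density `|det R|² / q^r`
up to a constant depending only on the dimension (`wedgePow_neg_log_rowNormSq`). That constant,
`stdWedge`, never has to be evaluated.

For `S = Sym^d h` the norm of `f^{⊗d}` is `|f|^d`, so the integrand is a form of bidegree `(d, d)`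
in `a` divided by `q^{r+d}`. Writing `a = t (1, z)` and integrating out `t` identifies its chart
integral with a Gaussian integral over `ℂ^r` (`integral_cone`). After the substitution `a ↦ a R`
this is a Gaussian moment. Moments of monomials count the permutations matching two index words,
which is exactly the sum defining `Sym^d h` (`gaussian_powPairing`). Thus part 1 holds with a
constant in which `|det R|²` has cancelled.

For part 2, put `δ = ‖H - S‖`. Then `|·|_H²` lies between `1 - δ` and `1 + δ` times `|·|_S²`, the
squared dual norms compare inversely, and the two integrands differ pointwise by at most `δ |v|_S
|w|_S` times the density. Its total mass is finite and depends only on `r`. Combining this with part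
1 for `S` and `|⟨v, w⟩_H - ⟨v, w⟩_S| ≤ δ |v|_S |w|_S`, and replacing `S`-norms by `H`-norms, gives
the estimate. -/

theorem le_sqrt_mul {a b c : ℝ} (hc : 0 ≤ c) (hb : 0 ≤ b) (h : a ^ 2 ≤ c * b ^ 2) :
    a ≤ Real.sqrt c * b := by
  have := Real.le_sqrt_of_sq_le h
  rwa [Real.sqrt_mul hc, Real.sqrt_sq hb] at this

/-! ### Hermitian norms, dual norms and their perturbation -/

section HermitianNorms

variable {W : Type*} [AddCommGroup W] [Module ℂ W]

theorem herm_self (H : InnerProductSpace.Core ℂ W) (v : W) :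
    herm H v v = ((hermNorm H v ^ 2 : ℝ) : ℂ) := by
  have h1 : conj (herm H v v) = herm H v v := H.conj_inner_symm v v
  have h2 : Real.sqrt (herm H v v).re ^ 2 = (herm H v v).re := Real.sq_sqrt (H.re_inner_nonneg v)
  rw [hermNorm, h2]
  exact (Complex.conj_eq_iff_re.1 h1).symm

theorem hermNorm_nonneg (H : InnerProductSpace.Core ℂ W) (v : W) : 0 ≤ hermNorm H v :=
  Real.sqrt_nonneg _

theorem norm_herm_le (H : InnerProductSpace.Core ℂ W) (v w : W) :
    ‖herm H v w‖ ≤ hermNorm H v * hermNorm H w := by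
  let _ : NormedAddCommGroup W := H.toNormedAddCommGroup
  let _ : InnerProductSpace ℂ W := InnerProductSpace.ofCore H.toCore
  rw [mul_comm]
  exact norm_inner_le_norm (𝕜 := ℂ) w v

theorem hermNorm_smul (H : InnerProductSpace.Core ℂ W) (c : ℂ) (v : W) :
    hermNorm H (c • v) = ‖c‖ * hermNorm H v := by
  let _ : NormedAddCommGroup W := H.toNormedAddCommGroup
  let _ : InnerProductSpace ℂ W := InnerProductSpace.ofCore H.toCore
  exact norm_smul c v

theorem hermNorm_eq_zero (H : InnerProductSpace.Core ℂ W) {v : W} :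
    hermNorm H v = 0 ↔ v = 0 := by
  let _ : NormedAddCommGroup W := H.toNormedAddCommGroup
  exact norm_eq_zero (E := W)

theorem herm_smul_left (H : InnerProductSpace.Core ℂ W) (c : ℂ) (v w : W) :
    herm H (c • v) w = c * herm H v w := (innerFunctional H w).map_smul c v

theorem herm_smul_right (H : InnerProductSpace.Core ℂ W) (c : ℂ) (v w : W) :
    herm H v (c • w) = conj c * herm H v w := H.smul_left w v c

theorem exists_eq_herm [FiniteDimensional ℂ W] (H : InnerProductSpace.Core ℂ W)
    (φ : Module.Dual ℂ W) : ∃ u, ∀ w, φ w = herm H w u := by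
  let _ : NormedAddCommGroup W := H.toNormedAddCommGroup
  let _ : InnerProductSpace ℂ W := InnerProductSpace.ofCore H.toCore
  refine ⟨(InnerProductSpace.toDual ℂ W).symm φ.toContinuousLinearMap, fun w => ?_⟩
  exact (InnerProductSpace.toDual_symm_apply (𝕜 := ℂ) (x := w)
    (y := φ.toContinuousLinearMap)).symm

/-- Cauchy–Schwarz gives one inequality; the unit vector `u / |u|` attains the supremum. -/
theorem dualNorm_eq_hermNorm (H : InnerProductSpace.Core ℂ W) {φ : Module.Dual ℂ W} {u : W}
    (hu : ∀ w, φ w = herm H w u) : dualNorm H φ = hermNorm H u := by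
  have hle : ∀ x ∈ {x : ℝ | ∃ w : W, hermNorm H w ≤ 1 ∧ x = ‖φ w‖}, x ≤ hermNorm H u := by
    rintro _ ⟨w, hw, rfl⟩
    rw [hu]
    exact (norm_herm_le H w u).trans (mul_le_of_le_one_left (hermNorm_nonneg H u) hw)
  have hn : hermNorm H (0 : W) = 0 := (hermNorm_eq_zero H).2 rfl
  refine le_antisymm (csSup_le ⟨_, 0, by simp [hn], rfl⟩ hle) ?_
  refine le_csSup ⟨_, hle⟩ ?_
  by_cases h0 : hermNorm H u = 0
  · exact ⟨0, by simp [hn], by simp [h0]⟩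
  · refine ⟨((hermNorm H u : ℝ) : ℂ)⁻¹ • u, ?_, ?_⟩
    · rw [hermNorm_smul, norm_inv, Complex.norm_real, Real.norm_of_nonneg (hermNorm_nonneg H u),
        inv_mul_cancel₀ h0]
    · rw [hu, herm_smul_left, herm_self, norm_mul, norm_inv, Complex.norm_real, Complex.norm_real,
        Real.norm_of_nonneg (hermNorm_nonneg H u), Real.norm_of_nonneg (by positivity)]
      field_simp

theorem hermDist_nonneg (H S : InnerProductSpace.Core ℂ W) : 0 ≤ hermDist H S := by
  refine Real.sSup_nonneg ?_
  rintro _ ⟨v, w, _, _, rfl⟩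
  exact norm_nonneg _

variable [FiniteDimensional ℂ W]

theorem norm_apply_le_dualNorm (H : InnerProductSpace.Core ℂ W) (φ : Module.Dual ℂ W) (w : W) :
    ‖φ w‖ ≤ dualNorm H φ * hermNorm H w := by
  obtain ⟨u, hu⟩ := exists_eq_herm H φ
  rw [dualNorm_eq_hermNorm H hu, hu, mul_comm]
  exact norm_herm_le H w u

theorem dualNorm_nonneg (H : InnerProductSpace.Core ℂ W) (φ : Module.Dual ℂ W) :
    0 ≤ dualNorm H φ := by
  obtain ⟨u, hu⟩ := exists_eq_herm H φ
  rw [dualNorm_eq_hermNorm H hu]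
  exact hermNorm_nonneg H u

/-- Parseval's identity for the dual norm. -/
theorem dualNorm_sq (H : InnerProductSpace.Core ℂ W) {ι : Type*} [Fintype ι] {e : ι → W}
    (he : ∀ w : W, ∑ j, herm H w (e j) • e j = w) (φ : Module.Dual ℂ W) :
    dualNorm H φ ^ 2 = ∑ j, ‖φ (e j)‖ ^ 2 := by
  obtain ⟨u, hu⟩ := exists_eq_herm H φ
  rw [dualNorm_eq_hermNorm H hu]
  have h1 : φ u = ∑ j, herm H u (e j) * φ (e j) := by
    conv_lhs => rw [← he u]
    simp
  rw [hu u, herm_self] at h1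
  apply Complex.ofReal_injective
  rw [h1]
  push_cast
  refine Finset.sum_congr rfl fun j _ => ?_
  rw [hu, ← Complex.conj_mul']
  congr 1
  exact (H.conj_inner_symm _ _).symm

theorem dualNorm_le_of_hermNorm_le (H S : InnerProductSpace.Core ℂ W) {c : ℝ} (hc : 0 ≤ c)
    (h : ∀ w, hermNorm S w ≤ c * hermNorm H w) (φ : Module.Dual ℂ W) :
    dualNorm H φ ≤ c * dualNorm S φ := by
  refine Real.sSup_le ?_ (mul_nonneg hc (dualNorm_nonneg S φ))
  rintro _ ⟨w, hw, rfl⟩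
  calc ‖φ w‖ ≤ dualNorm S φ * hermNorm S w := norm_apply_le_dualNorm S φ w
    _ ≤ dualNorm S φ * c := by
      refine mul_le_mul_of_nonneg_left ?_ (dualNorm_nonneg S φ)
      exact (h w).trans (mul_le_of_le_one_right hc hw)
    _ = _ := mul_comm _ _

/-- By homogeneity it suffices to treat unit vectors. There the supremum `hermDist` is an upper
bound only once its set is known to be bounded, which is where finite dimension enters. -/
theorem norm_herm_sub_le (H S : InnerProductSpace.Core ℂ W) (v w : W) :
    ‖herm H v w - herm S v w‖ ≤ hermDist H S * hermNorm S v * hermNorm S w := by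
  obtain ⟨M, hM⟩ : ∃ M : ℝ, ∀ w, hermNorm S w ≤ 1 → hermNorm H w ≤ M := by
    let _ : NormedAddCommGroup W := S.toNormedAddCommGroup
    let _ : InnerProductSpace ℂ W := InnerProductSpace.ofCore S.toCore
    obtain ⟨n, e, he⟩ := exists_orthonormal_expansion H
    -- The `H`-orthonormal coordinates are linear, hence continuous for the norm of `S`; this bounds
    -- the `H`-norm on the `S`-unit ball.
    let T : W →ₗ[ℂ] (Fin n → ℂ) := LinearMap.pi fun j => innerFunctional H (e j)
    let T' := T.toContinuousLinearMap
    have hT : ∀ w, hermNorm H w ^ 2 = ∑ j, ‖T w j‖ ^ 2 := by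
      intro w
      have h1 : herm H w w = ∑ j, herm H w (e j) * herm H (e j) w := by
        have := congrArg (innerFunctional H w) (he w)
        rw [map_sum] at this
        simp only [map_smul, smul_eq_mul] at this
        exact this.symm
      rw [herm_self] at h1
      apply Complex.ofReal_injective
      rw [h1]
      push_cast
      refine Finset.sum_congr rfl fun j _ => ?_
      rw [← Complex.mul_conj']
      congr 1
      exact (H.conj_inner_symm _ _).symm
    refine ⟨Real.sqrt (∑ j : Fin n, ‖T'‖ ^ 2), fun w hw => Real.le_sqrt_of_sq_le ?_⟩
    rw [hT]
    refine Finset.sum_le_sum fun j _ => pow_le_pow_left₀ (norm_nonneg _) ?_ 2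
    calc ‖T w j‖ ≤ ‖T' w‖ := norm_le_pi_norm (T' w) j
      _ ≤ ‖T'‖ * ‖w‖ := T'.le_opNorm w
      _ ≤ ‖T'‖ := mul_le_of_le_one_right (norm_nonneg T') hw
  have hbdd : BddAbove {x : ℝ | ∃ v w : W, hermNorm S v ≤ 1 ∧ hermNorm S w ≤ 1 ∧
      x = ‖herm H v w - herm S v w‖} := by
    refine ⟨M * M + 1, ?_⟩
    rintro _ ⟨v, w, hv, hw, rfl⟩
    refine (norm_sub_le _ _).trans (add_le_add ?_ ?_)
    · exact (norm_herm_le H v w).trans (mul_le_mul (hM v hv) (hM w hw) (hermNorm_nonneg H w)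
        ((hermNorm_nonneg H v).trans (hM v hv)))
    · exact (norm_herm_le S v w).trans (mul_le_one₀ hv (hermNorm_nonneg S w) hw)
  have hz : ∀ u, hermNorm S u = 0 → u = 0 := fun u => (hermNorm_eq_zero S).1
  by_cases hv : hermNorm S v = 0
  · rw [hv, hz v hv, ← zero_smul ℂ (0 : W), herm_smul_left, herm_smul_left]
    simp
  by_cases hw : hermNorm S w = 0
  · rw [hw, hz w hw, ← zero_smul ℂ (0 : W), herm_smul_right, herm_smul_right]
    simp
  have hv' := lt_of_le_of_ne (hermNorm_nonneg S v) (Ne.symm hv)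
  have hw' := lt_of_le_of_ne (hermNorm_nonneg S w) (Ne.symm hw)
  have hunit : ∀ u, hermNorm S u ≠ 0 → hermNorm S (((hermNorm S u : ℝ) : ℂ)⁻¹ • u) ≤ 1 := by
    intro u hu
    rw [hermNorm_smul, norm_inv, Complex.norm_real, Real.norm_of_nonneg (hermNorm_nonneg S u),
        inv_mul_cancel₀ hu]
  have key := le_csSup hbdd ⟨_, _, hunit v hv, hunit w hw, rfl⟩
  rw [herm_smul_left, herm_smul_left, herm_smul_right, herm_smul_right, ← mul_sub, ← mul_sub,
    norm_mul, norm_mul, RCLike.norm_conj, norm_inv, norm_inv, Complex.norm_real, Complex.norm_real,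
    Real.norm_of_nonneg hv'.le, Real.norm_of_nonneg hw'.le] at key
  change _ ≤ hermDist H S at key
  rwa [inv_mul_le_iff₀ hv', inv_mul_le_iff₀ hw', mul_comm (hermNorm S v), mul_comm (hermNorm S w)]
    at key

theorem abs_hermNorm_sq_sub_le (H S : InnerProductSpace.Core ℂ W) (v : W) :
    |hermNorm H v ^ 2 - hermNorm S v ^ 2| ≤ hermDist H S * hermNorm S v ^ 2 := by
  have := norm_herm_sub_le H S v v
  rw [herm_self, herm_self, ← Complex.ofReal_sub, Complex.norm_real, Real.norm_eq_abs] at this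
  linarith

/-- The inverse square of the dual norm is as close as the norms are. -/
theorem abs_inv_dualNorm_sq_sub_le (H S : InnerProductSpace.Core ℂ W) (hδ : hermDist H S < 1)
    (φ : Module.Dual ℂ W) :
    |(dualNorm H φ ^ 2)⁻¹ - (dualNorm S φ ^ 2)⁻¹| ≤ hermDist H S * (dualNorm S φ ^ 2)⁻¹ := by
  set δ := hermDist H S with hδdef
  have hδ0 : 0 ≤ δ := hermDist_nonneg H S
  have h1 : ∀ w, hermNorm H w ≤ Real.sqrt (1 + δ) * hermNorm S w := fun w => by
    refine le_sqrt_mul (by linarith) (hermNorm_nonneg S w) ?_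
    have := (abs_le.1 (abs_hermNorm_sq_sub_le H S w)).2
    linarith
  have h2 : ∀ w, hermNorm S w ≤ Real.sqrt (1 - δ)⁻¹ * hermNorm H w := fun w => by
    refine le_sqrt_mul (inv_nonneg.2 (by linarith)) (hermNorm_nonneg H w) ?_
    have := (abs_le.1 (abs_hermNorm_sq_sub_le H S w)).1
    rw [inv_mul_eq_div, le_div_iff₀ (by linarith)]
    linarith
  have d1 := pow_le_pow_left₀ (dualNorm_nonneg S φ)
    (dualNorm_le_of_hermNorm_le S H (Real.sqrt_nonneg _) h1 φ) 2
  have d2 := pow_le_pow_left₀ (dualNorm_nonneg H φ)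
    (dualNorm_le_of_hermNorm_le H S (Real.sqrt_nonneg _) h2 φ) 2
  rw [mul_pow, Real.sq_sqrt (by linarith)] at d1
  rw [mul_pow, Real.sq_sqrt (inv_nonneg.2 (by linarith))] at d2
  set x := dualNorm H φ ^ 2
  set y := dualNorm S φ ^ 2
  have hx : 0 ≤ x := by positivity
  have hy : 0 ≤ y := by positivity
  -- If one dual norm vanishes so does the other, and both inverses are `0` by convention.
  rcases hx.eq_or_lt with hx0 | hx0
  · rw [← hx0] at d1 ⊢
    have : y = 0 := le_antisymm (by simpa using d1) hy
    simp [this]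
  rcases hy.eq_or_lt with hy0 | hy0
  · rw [← hy0] at d2
    simp at d2
    linarith
  have e1 : x⁻¹ ≤ (1 + δ) * y⁻¹ := by
    rw [← div_eq_mul_inv, le_div_iff₀ hy0, inv_mul_le_iff₀ hx0]
    linarith
  have e2 : (1 - δ) * y⁻¹ ≤ x⁻¹ := by
    rw [inv_mul_eq_div, le_div_iff₀ (by linarith)] at d2
    rw [← div_eq_mul_inv, div_le_iff₀ hy0, inv_mul_eq_div, le_div_iff₀ hx0]
    linarith
  rw [abs_le]
  constructor <;> linarith

end HermitianNorms

/-! ### The norm of `f^{⊗d}` -/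

section PowFunctional

variable {V : Type*} [AddCommGroup V] [Module ℂ V] [FiniteDimensional ℂ V] {d : ℕ}

instance : FiniteDimensional ℂ (SymPow d V) :=
  Module.Finite.of_surjective _ (LinearMap.range_eq_top.1 (SymmetricPower.range_mk ℂ (Fin d) V))

/-- The products `e_{p 1} ⋯ e_{p d}`, over all words `p`, satisfy the expansion identity for `Sym^d
h` even though they repeat. Parseval then gives a sum over words of products, which factors as a
`d`-th power. -/
theorem dualNorm_symInner_powFunctional (h : InnerProductSpace.Core ℂ V) (f : Module.Dual ℂ V) :
    dualNorm (symInner d h) (powFunctional d f) ^ 2 = (dualNorm h f ^ 2) ^ d := by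
  obtain ⟨n, e, he⟩ := exists_orthonormal_expansion h
  rw [dualNorm_sq h he, dualNorm_sq (symInner d h) (symForm_expansion h he)]
  simp only [powFunctional_symMk, norm_prod]
  have := (Finset.prod_univ_sum (fun _ : Fin d => (Finset.univ : Finset (Fin n)))
    (fun _ j => ‖f (e j)‖ ^ 2)).symm
  simp only [Finset.prod_const, Finset.card_univ, Fintype.card_fin] at this
  rw [← this]
  simp [Finset.prod_pow, Fintype.piFinset_univ]

end PowFunctional

/-! ### Top exterior powers of two-forms -/

section Wedge

section StdForm

variable {κ : Type*} [Fintype κ]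

/-- The form `i (⟨w, u⟩ - ⟨u, w⟩)` on `ℂ^κ`. -/
def stdForm (κ : Type*) [Fintype κ] : (κ → ℂ) →ₗ[ℝ] (κ → ℂ) →ₗ[ℝ] ℂ :=
  LinearMap.mk₂ ℝ (fun w u => Complex.I * (w ⬝ᵥ star u - u ⬝ᵥ star w))
    (fun a b c => by simp only [add_dotProduct, star_add, dotProduct_add]; ring)
    (fun r a b => by
      simp only [smul_dotProduct, star_smul, dotProduct_smul, star_trivial, Complex.real_smul]
      ring)
    (fun a b c => by simp only [add_dotProduct, star_add, dotProduct_add]; ring)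
    (fun r a b => by
      simp only [smul_dotProduct, star_smul, dotProduct_smul, star_trivial, Complex.real_smul]
      ring)

theorem stdForm_apply (w u : κ → ℂ) :
    stdForm κ w u = Complex.I * (w ⬝ᵥ star u - u ⬝ᵥ star w) := rfl

theorem conj_stdForm (w u : κ → ℂ) : conj (stdForm κ w u) = stdForm κ w u := by
  have : ∀ a b : κ → ℂ, conj (a ⬝ᵥ star b) = b ⬝ᵥ star a := fun a b => by
    simp [dotProduct, mul_comm]
  rw [stdForm_apply, map_mul, map_sub, this, this, Complex.conj_I]
  ring

end StdForm

variable {κ : Type*} [Fintype κ] [DecidableEq κ] {E : Type*} [AddCommGroup E] [Module ℝ E]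

/-- The multilinear map `v ↦ ∏_k β(v (k, 0), v (k, 1))`. -/
def pairProd (κ : Type*) [Fintype κ] (β : E →ₗ[ℝ] E →ₗ[ℝ] ℂ) :
    MultilinearMap ℝ (fun _ : κ × Fin 2 => E) ℂ where
  toFun v := ∏ k : κ, β (v (k, 0)) (v (k, 1))
  map_update_add' := by
    classical
    rintro inst v ⟨k, j⟩ x y
    obtain rfl : inst = instDecidableEqProd := Subsingleton.elim _ _
    have hne : ∀ (z : E), ∀ l ∈ (Finset.univ : Finset κ).erase k,
        β (Function.update v (k, j) z (l, 0)) (Function.update v (k, j) z (l, 1))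
          = β (v (l, 0)) (v (l, 1)) := by
      intro z l hl
      have : l ≠ k := Finset.ne_of_mem_erase hl
      rw [Function.update_of_ne (by simp [this]), Function.update_of_ne (by simp [this])]
    rw [← Finset.mul_prod_erase _ _ (Finset.mem_univ k),
      ← Finset.mul_prod_erase _ _ (Finset.mem_univ k),
      ← Finset.mul_prod_erase _ _ (Finset.mem_univ k), Finset.prod_congr rfl (hne _),
      Finset.prod_congr rfl (hne _), Finset.prod_congr rfl (hne _), ← add_mul]
    congr 1
    fin_cases j <;> simp
  map_update_smul' := by
    classical
    rintro inst v ⟨k, j⟩ c x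
    obtain rfl : inst = instDecidableEqProd := Subsingleton.elim _ _
    have hne : ∀ (z : E), ∀ l ∈ (Finset.univ : Finset κ).erase k,
        β (Function.update v (k, j) z (l, 0)) (Function.update v (k, j) z (l, 1))
          = β (v (l, 0)) (v (l, 1)) := by
      intro z l hl
      have : l ≠ k := Finset.ne_of_mem_erase hl
      rw [Function.update_of_ne (by simp [this]), Function.update_of_ne (by simp [this])]
    rw [← Finset.mul_prod_erase _ _ (Finset.mem_univ k),
      ← Finset.mul_prod_erase _ _ (Finset.mem_univ k), Finset.prod_congr rfl (hne _),
      Finset.prod_congr rfl (hne _), ← smul_mul_assoc]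
    congr 1
    fin_cases j <;> simp

/-- The top wedge power of a bilinear form, as an alternating map. -/
def bilWedge (κ : Type*) [Fintype κ] [DecidableEq κ] (β : E →ₗ[ℝ] E →ₗ[ℝ] ℂ) :
    E [⋀^κ × Fin 2]→ₗ[ℝ] ℂ :=
  (1 / 2 ^ Fintype.card κ : ℂ) • (pairProd κ β).alternatization

theorem bilWedge_apply (β : E →ₗ[ℝ] E →ₗ[ℝ] ℂ) (v : κ × Fin 2 → E) :
    bilWedge κ β v = (1 / 2 ^ Fintype.card κ : ℂ) * ∑ σ : Equiv.Perm (κ × Fin 2),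
      ((Equiv.Perm.sign σ : ℤ) : ℂ) * ∏ k : κ, β (v (σ (k, 0))) (v (σ (k, 1))) := by
  rw [bilWedge, AlternatingMap.smul_apply, smul_eq_mul, MultilinearMap.alternatization_apply]
  congr 1
  refine Finset.sum_congr rfl fun σ _ => ?_
  rw [Units.smul_def, zsmul_eq_mul]
  rfl

/-- Real and imaginary parts are real top-degree forms, each a multiple of the determinant. -/
theorem AlternatingMap.map_comp_eq_det {ι : Type*} [Fintype ι] [DecidableEq ι]
    (e : Module.Basis ι ℝ E) (A : E [⋀^ι]→ₗ[ℝ] ℂ) (T : E →ₗ[ℝ] E) (v : ι → E) :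
    A (T ∘ v) = (LinearMap.det T : ℝ) * A v := by
  have key : ∀ g : ℂ →ₗ[ℝ] ℝ, g (A (T ∘ v)) = LinearMap.det T * g (A v) := by
    intro g
    have h := AlternatingMap.eq_smul_basis_det e (g.compAlternatingMap A)
    have h1 : g (A (T ∘ v)) = (g.compAlternatingMap A) (T ∘ v) := rfl
    have h2 : g (A v) = (g.compAlternatingMap A) v := rfl
    rw [h1, h2, h, AlternatingMap.smul_apply, AlternatingMap.smul_apply, Module.Basis.det_comp]
    simp only [smul_eq_mul]
    ring
  apply Complex.ext
  · simpa using key Complex.reLm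
  · simpa using key Complex.imLm

/-- The value of the top wedge power of `stdForm` on the oriented frame. -/
def stdWedge (κ : Type*) [Fintype κ] [DecidableEq κ] : ℝ :=
  (bilWedge κ (stdForm κ) (orientedFrame κ)).re

theorem bilWedge_stdForm : bilWedge κ (stdForm κ) (orientedFrame κ) = stdWedge κ := by
  refine (Complex.conj_eq_iff_re.1 ?_).symm
  rw [bilWedge_apply]
  simp only [map_mul, map_sum, map_prod, conj_stdForm]
  simp [Complex.conj_ofNat]

/-- The form depends on `N` only through `N Nᴴ`, which equals `B Bᴴ` for a square `B`. So `ω` is the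
pullback of `stdForm` under the endomorphism `w ↦ q^{-1/2} w B`, and its top power scales by the
real determinant of that map, the squared modulus of its complex determinant. -/
theorem wedgePow_of_gram {ι : Type*} [Fintype ι] (N : Matrix κ ι ℂ) {q : ℝ} (hq : 0 < q)
    {ω : (κ → ℂ) [⋀^Fin 2]→L[ℝ] ℂ}
    (hω : ∀ w u, ω ![w, u] = Complex.I * ((Matrix.vecMul w N) ⬝ᵥ star (Matrix.vecMul u N)
      - (Matrix.vecMul u N) ⬝ᵥ star (Matrix.vecMul w N)) / q) :
    wedgePow ω (orientedFrame κ)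
      = (N * N.conjTranspose).det / (q : ℂ) ^ Fintype.card κ * stdWedge κ := by
  obtain ⟨B, hB⟩ : ∃ B : Matrix κ κ ℂ, N * N.conjTranspose = B * B.conjTranspose := by
    open scoped MatrixOrder ComplexOrder in
    obtain ⟨B, hB⟩ := CStarAlgebra.nonneg_iff_eq_star_mul_self.1
      (Matrix.posSemidef_self_mul_conjTranspose N).nonneg
    exact ⟨star B, by simpa [Matrix.star_eq_conjTranspose] using hB⟩
  have hgram : ∀ w u : κ → ℂ, (Matrix.vecMul w N) ⬝ᵥ star (Matrix.vecMul u N)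
      = (Matrix.vecMul w B) ⬝ᵥ star (Matrix.vecMul u B) := by
    intro w u
    rw [Matrix.star_vecMul, Matrix.star_vecMul, Matrix.dotProduct_mulVec, Matrix.dotProduct_mulVec,
      Matrix.vecMul_vecMul, Matrix.vecMul_vecMul, hB]
  set s : ℝ := (Real.sqrt q)⁻¹ with hs
  have hs2 : (s : ℂ) * s = (q : ℂ)⁻¹ := by
    rw [← Complex.ofReal_mul, hs, ← mul_inv, Real.mul_self_sqrt hq.le, Complex.ofReal_inv]
  let T : (κ → ℂ) →ₗ[ℂ] (κ → ℂ) := Matrix.toLin' ((s : ℂ) • B).transpose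
  have hT : ∀ w, T w = (s : ℂ) • Matrix.vecMul w B := fun w => by
    rw [Matrix.toLin'_apply, Matrix.mulVec_transpose, Matrix.vecMul_smul]
  have h1 : ∀ w u, ω ![w, u] = stdForm κ (T w) (T u) := by
    intro w u
    rw [hω, hgram, hgram, stdForm_apply, hT, hT]
    simp only [smul_dotProduct, star_smul, dotProduct_smul, smul_eq_mul, Complex.star_def,
      Complex.conj_ofReal]
    rw [div_eq_mul_inv, ← hs2]
    ring
  have h2 : wedgePow ω (orientedFrame κ)
      = bilWedge κ (stdForm κ) (T.restrictScalars ℝ ∘ orientedFrame κ) := by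
    rw [bilWedge_apply, wedgePow]
    simp only [h1]
    rfl
  rw [h2, AlternatingMap.map_comp_eq_det ((Pi.basis fun _ : κ => Complex.basisOneI).reindex
    (Equiv.sigmaEquivProd κ (Fin 2))), bilWedge_stdForm, LinearMap.det_restrictScalars]
  congr 1
  rw [Algebra.norm_complex_apply, ← Complex.mul_conj, LinearMap.det_toLin', Matrix.det_transpose,
    Matrix.det_smul, map_mul, map_pow, Complex.conj_ofReal, hB, Matrix.det_mul,
    Matrix.det_conjTranspose, div_eq_mul_inv, ← inv_pow, ← hs2, mul_pow]
  simp only [Complex.star_def]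
  ring

end Wedge

/-! ### The Gram determinant of the projected rows -/

section Gram

variable {ι : Type*} [Fintype ι] (j : ι)

/-- The homogeneous coordinates of the point of the `j`-th affine chart with coordinates `z`. -/
def affineVec [DecidableEq ι] (z : {i : ι // i ≠ j} → ℂ) (i : ι) : ℂ :=
  if h : i ≠ j then z ⟨i, h⟩ else 1

/-- The rows `R k - (⟨R k, x⟩ / ⟨x, x⟩) x` for `k ≠ j`, where `x = (1, z) R`. -/
def projRows (R : Matrix ι ι ℂ) (x : ι → ℂ) : Matrix {i : ι // i ≠ j} ι ℂ :=
  fun k => R k - ((R k ⬝ᵥ star x) / (x ⬝ᵥ star x)) • x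

variable {j}

theorem mul_conjTranspose_apply_eq {m : Type*} (M : Matrix m ι ℂ) (a b : m) :
    (M * M.conjTranspose) a b = M a ⬝ᵥ star (M b) := rfl

/-- Replacing row `j` of `R` by `x` and subtracting multiples of `x` from the other rows preserves
the determinant. In the resulting `M` the row `x` is orthogonal to all the others, so `M Mᴴ` splits
into the blocks `⟨x, x⟩` and the Gram matrix of the projected rows. -/
theorem det_projRows_gram [DecidableEq ι] (R : Matrix ι ι ℂ) (z : {i : ι // i ≠ j} → ℂ)
    {x : ι → ℂ} (hx : x = Matrix.vecMul (affineVec j z) R) (hx0 : x ⬝ᵥ star x ≠ 0) :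
    (projRows j R x * (projRows j R x).conjTranspose).det * (x ⬝ᵥ star x)
      = R.det * conj R.det := by
  set c : ι → ℂ := fun i => (R i ⬝ᵥ star x) / (x ⬝ᵥ star x) with hc
  -- `F` and `E` are the two unipotent row operations, with `E * (F * R) = M`.
  let F : Matrix ι ι ℂ := Matrix.of fun i => if i = j then affineVec j z else Pi.single i 1
  let E : Matrix ι ι ℂ :=
    Matrix.of fun i => if i = j then Pi.single j 1 else Pi.single i 1 - c i • Pi.single j 1
  have hFj : F j = affineVec j z := if_pos rfl
  have hFi : ∀ i, i ≠ j → F i = Pi.single i 1 := fun i hi => if_neg hi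
  have hEj : E j = Pi.single j 1 := if_pos rfl
  have hEi : ∀ i, i ≠ j → E i = Pi.single i 1 - c i • Pi.single j 1 := fun i hi => if_neg hi
  have hF : F.det = 1 := by
    rw [Matrix.twoBlockTriangular_det F (· = j)]
    · have h1 : F.toSquareBlockProp (· = j) = 1 := by
        ext ⟨a, ha⟩ ⟨b, hb⟩
        have : (⟨a, ha⟩ : {a // a = j}) = ⟨b, hb⟩ := Subsingleton.elim _ _
        rw [this, Matrix.one_apply_eq, Matrix.toSquareBlockProp_def, Matrix.of_apply]
        simp [hb, hFj, affineVec]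
      have h2 : (F.toSquareBlockProp fun i => ¬ i = j) = 1 := by
        ext ⟨a, ha⟩ ⟨b, hb⟩
        rw [Matrix.toSquareBlockProp_def, Matrix.of_apply]
        change F a b = _
        rw [hFi a ha]
        simp [Matrix.one_apply, Pi.single_apply, eq_comm]
      rw [h1, h2]; simp
    · rintro i hi k rfl
      rw [hFi i hi, Pi.single_apply, if_neg (Ne.symm hi)]
  have hE : E.det = 1 := by
    rw [Matrix.twoBlockTriangular_det' E (· = j)]
    · have h1 : E.toSquareBlockProp (· = j) = 1 := by
        ext ⟨a, ha⟩ ⟨b, hb⟩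
        have : (⟨a, ha⟩ : {a // a = j}) = ⟨b, hb⟩ := Subsingleton.elim _ _
        rw [this, Matrix.one_apply_eq, Matrix.toSquareBlockProp_def, Matrix.of_apply]
        simp [hb, hEj]
      have h2 : (E.toSquareBlockProp fun i => ¬ i = j) = 1 := by
        ext ⟨a, ha⟩ ⟨b, hb⟩
        rw [Matrix.toSquareBlockProp_def, Matrix.of_apply]
        change E a b = _
        rw [hEi a ha, Pi.sub_apply, Pi.smul_apply, Pi.single_apply j 1 b, if_neg hb]
        simp [Matrix.one_apply, Pi.single_apply, eq_comm]
      rw [h1, h2]; simp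
    · rintro i rfl k hk
      rw [hEj, Pi.single_apply, if_neg hk]
  set M : Matrix ι ι ℂ := Matrix.of fun i => if i = j then x else R i - c i • x with hM
  have hMj : M j = x := if_pos rfl
  have hMi : ∀ i, i ≠ j → M i = R i - c i • x := fun i hi => if_neg hi
  have hFR : ∀ i, (F * R) i = if i = j then x else R i := by
    intro i
    rw [Matrix.mul_apply_eq_vecMul]
    by_cases h : i = j
    · rw [h, hFj, if_pos rfl, hx]
    · rw [hFi i h, if_neg h, Matrix.single_one_vecMul]; rfl
  have hEFR : E * (F * R) = M := by
    funext i
    rw [Matrix.mul_apply_eq_vecMul]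
    by_cases h : i = j
    · rw [h, hMj, hEj, Matrix.single_one_vecMul]
      exact (hFR j).trans (if_pos rfl)
    · rw [hMi i h, hEi i h, Matrix.sub_vecMul, Matrix.smul_vecMul,
        Matrix.single_one_vecMul, Matrix.single_one_vecMul]
      exact congrArg₂ (fun a b => a - c i • b) ((hFR i).trans (if_neg h))
        ((hFR j).trans (if_pos rfl))
  have hdet : M.det = R.det := by
    rw [← hEFR, Matrix.det_mul, Matrix.det_mul, hE, hF, one_mul, one_mul]
  have horth : ∀ i, i ≠ j → M i ⬝ᵥ star x = 0 := by
    intro i hi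
    rw [hMi i hi, sub_dotProduct, smul_dotProduct, smul_eq_mul, div_mul_cancel₀ _ hx0, sub_self]
  rw [← hdet]
  change _ = M.det * star M.det
  rw [← Matrix.det_conjTranspose, ← Matrix.det_mul,
    Matrix.twoBlockTriangular_det (M * M.conjTranspose) (· = j), mul_comm]
  · congr 1
    · refine Eq.trans ?_ (Matrix.det_eq_elem_of_subsingleton
        ((M * M.conjTranspose).toSquareBlockProp (· = j)) ⟨j, rfl⟩).symm |>.trans (by congr!)
      rw [Matrix.toSquareBlockProp_def, Matrix.of_apply, mul_conjTranspose_apply_eq, hMj]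
    · congr 1
      ext ⟨a, ha⟩ ⟨b, hb⟩
      rw [Matrix.toSquareBlockProp_def, Matrix.of_apply, mul_conjTranspose_apply_eq,
        mul_conjTranspose_apply_eq, hMi a ha, hMi b hb]
      rfl
  · rintro i hi k rfl
    rw [mul_conjTranspose_apply_eq, hMj, horth i hi]

end Gram

/-! ### The form `i ∂̄∂` of minus the logarithm of a sum of squares -/

section LogNormSq

variable {E : Type*} [NormedAddCommGroup E] [NormedSpace ℂ E] {ι : Type*} [Fintype ι]
  {x : ι → E → ℂ} {A : ι → E →L[ℂ] ℂ}

theorem hasFDerivAt_sum_norm_sq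
    (hx : ∀ k z, HasFDerivAt (x k) ((A k).restrictScalars ℝ) z) (z : E) :
    HasFDerivAt (fun z => ∑ k, ‖x k z‖ ^ 2)
      (∑ k, 2 • (innerSL ℝ (x k z)).comp ((A k).restrictScalars ℝ)) z :=
  HasFDerivAt.fun_sum fun k _ => (hx k z).norm_sq

/-- The real derivative at `u` is `-2 Re S(u) / Q` with `S(u) = ∑ conj(x_k) A_k(u)` complex linear;
`del` keeps the complex linear part `S` of `2 Re S`. -/
theorem del_neg_log_sum_norm_sq (hx : ∀ k z, HasFDerivAt (x k) ((A k).restrictScalars ℝ) z) (z : E)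
    (h0 : ∑ k, ‖x k z‖ ^ 2 ≠ 0) :
    del (fun z => ((-Real.log (∑ k, ‖x k z‖ ^ 2) : ℝ) : ℂ)) z
      = ContinuousAlternatingMap.ofSubsingleton ℝ E ℂ (0 : Fin 1)
        (-((∑ k, ‖x k z‖ ^ 2 : ℝ) : ℂ)⁻¹ • ∑ k, conj (x k z) • (A k).restrictScalars ℝ) := by
  have h1 := Complex.ofRealCLM.hasFDerivAt.comp z ((hasFDerivAt_sum_norm_sq hx z).log h0).neg
  have h2 : fderiv ℝ (fun z => ((-Real.log (∑ k, ‖x k z‖ ^ 2) : ℝ) : ℂ)) z = _ := h1.fderiv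
  set S : E → ℂ := fun u => ∑ k, conj (x k z) * A k u with hS
  have hval : ∀ u, fderiv ℝ (fun z => ((-Real.log (∑ k, ‖x k z‖ ^ 2) : ℝ) : ℂ)) z u
      = -((∑ k, ‖x k z‖ ^ 2 : ℝ) : ℂ)⁻¹ * (2 * ((S u).re : ℂ)) := by
    intro u
    have h3 : (S u).re = ∑ k, (A k u * conj (x k z)).re := by
      rw [hS, Complex.re_sum]
      simp only [mul_comm]
    rw [h2, h3]
    simp only [ContinuousLinearMap.comp_apply, neg_apply, smul_apply, sum_apply, Complex.inner,
      innerSL_apply_apply, ContinuousLinearMap.coe_restrictScalars', Complex.ofRealCLM_apply,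
      smul_eq_mul, nsmul_eq_mul, ← Finset.mul_sum]
    push_cast
    ring
  have hI : ∀ u, S (Complex.I • u) = Complex.I * S u := by
    intro u
    simp only [hS, map_smul, smul_eq_mul, Finset.mul_sum]
    exact Finset.sum_congr rfl fun k _ => by ring
  rw [del]
  congr 1
  refine ContinuousLinearMap.ext fun u => ?_
  change (1 / 2 : ℂ) * (fderiv ℝ (fun z => ((-Real.log (∑ k, ‖x k z‖ ^ 2) : ℝ) : ℂ)) z u
    - Complex.I * fderiv ℝ (fun z => ((-Real.log (∑ k, ‖x k z‖ ^ 2) : ℝ) : ℂ)) z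
      (Complex.I • u)) = _
  rw [hval, hval, hI]
  have key : ∀ c : ℂ, (c.re : ℂ) - Complex.I * ((Complex.I * c).re : ℂ) = c := fun c => by
    apply Complex.ext <;> simp
  have hr : (-((∑ k, ‖x k z‖ ^ 2 : ℝ) : ℂ)⁻¹ • ∑ k, conj (x k z) • (A k).restrictScalars ℝ) u
      = -((∑ k, ‖x k z‖ ^ 2 : ℝ) : ℂ)⁻¹ * S u := by
    simp [S]
  rw [hr]
  linear_combination -((∑ k, ‖x k z‖ ^ 2 : ℝ) : ℂ)⁻¹ * key (S u)

/-- The derivatives `A k` are constant, so in `-Q⁻¹ ∑ conj(x_k) A_k` only `Q` and `conj(x_k)` are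
differentiated. The part of `dQ` without conjugation contributes a symmetric term, which cancels on
antisymmetrizing. -/
theorem iDelbarDel_neg_log_sum_norm_sq (hx : ∀ k z, HasFDerivAt (x k) ((A k).restrictScalars ℝ) z)
    (h0 : ∀ z, ∑ k, ‖x k z‖ ^ 2 ≠ 0) (z w u : E) :
    iDelbarDel (fun z => ((-Real.log (∑ k, ‖x k z‖ ^ 2) : ℝ) : ℂ)) z ![w, u]
      = Complex.I * ((∑ k, A k w * conj (A k u) - (∑ k, A k w * conj (x k z))
            * conj (∑ k, A k u * conj (x k z)) / (∑ k, ‖x k z‖ ^ 2 : ℝ))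
          - (∑ k, A k u * conj (A k w) - (∑ k, A k u * conj (x k z))
            * conj (∑ k, A k w * conj (x k z)) / (∑ k, ‖x k z‖ ^ 2 : ℝ)))
        / (∑ k, ‖x k z‖ ^ 2 : ℝ) := by
  set Q : E → ℝ := fun z => ∑ k, ‖x k z‖ ^ 2 with hQ
  have hdel : del (fun z => ((-Real.log (Q z) : ℝ) : ℂ)) = fun z =>
      ContinuousAlternatingMap.ofSubsingletonLIE (𝕜 := ℝ) (E := E) (F := ℂ) (0 : Fin 1)
        (-((Q z : ℝ) : ℂ)⁻¹ • ∑ k, conj (x k z) • (A k).restrictScalars ℝ) :=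
    funext fun z => del_neg_log_sum_norm_sq hx z (h0 z)
  have hQd := hasFDerivAt_sum_norm_sq hx z
  have hQi : HasFDerivAt (fun z => -((Q z : ℝ) : ℂ)⁻¹) _ z :=
    (HasFDerivAt.comp (𝕜 := ℝ) (f := fun z => ((Q z : ℝ) : ℂ)) z
      ((hasFDerivAt_inv (Complex.ofReal_ne_zero.2 (h0 z))).restrictScalars ℝ)
      (Complex.ofRealCLM.hasFDerivAt.comp z hQd)).neg
  have hc : ∀ k, HasFDerivAt (fun z => conj (x k z)) _ z := fun k =>
    Complex.conjCLE.toContinuousLinearMap.hasFDerivAt.comp z (hx k z)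
  have hd : DifferentiableAt ℝ (del (fun z => ((-Real.log (Q z) : ℝ) : ℂ))) z := by
    rw [hdel]
    refine (ContinuousAlternatingMap.ofSubsingletonLIE (𝕜 := ℝ) (E := E) (F := ℂ)
      (0 : Fin 1)).toContinuousLinearEquiv.differentiableAt.comp z ?_
    refine hQi.differentiableAt.smul (DifferentiableAt.fun_sum fun k _ => ?_)
    exact (hc k).differentiableAt.smul_const _
  have hdQ : ∀ b, ((∑ k, 2 • (innerSL ℝ (x k z)).comp ((A k).restrictScalars ℝ)) b : ℂ)
      = ∑ k, A k b * conj (x k z) + conj (∑ k, A k b * conj (x k z)) := by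
    intro b
    rw [Complex.add_conj, Complex.re_sum]
    simp only [ContinuousLinearMap.comp_apply, smul_apply, sum_apply, Complex.inner,
      innerSL_apply_apply, ContinuousLinearMap.coe_restrictScalars', nsmul_eq_mul,
      ← Finset.mul_sum]
    push_cast
    rfl
  have hg : ∀ (a b : E), fderiv ℝ (fun z => del (fun z => ((-Real.log (Q z) : ℝ) : ℂ)) z
        (fun _ => a)) z b
      = ((Q z : ℂ) ^ 2)⁻¹ * (∑ k, A k b * conj (x k z) + conj (∑ k, A k b * conj (x k z)))
          * (∑ k, A k a * conj (x k z)) - (Q z : ℂ)⁻¹ * ∑ k, A k a * conj (A k b) := by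
    intro a b
    have h1 : (fun z => del (fun z => ((-Real.log (Q z) : ℝ) : ℂ)) z (fun _ => a))
        = fun z => -((Q z : ℝ) : ℂ)⁻¹ * ∑ k, conj (x k z) * A k a := by
      rw [hdel]; funext z; simp
    have h2 : HasFDerivAt (fun z => -((Q z : ℝ) : ℂ)⁻¹ * ∑ k, conj (x k z) * A k a) _ z :=
      hQi.mul (HasFDerivAt.fun_sum fun k _ => (hc k).mul_const (A k a))
    have hs : ∑ k, A k a * conj (A k b) = ∑ k, A k a • conj (A k b) := rfl
    have hs' : ∑ k, A k a * conj (x k z) = ∑ k, conj (x k z) * A k a :=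
      Finset.sum_congr rfl fun k _ => mul_comm _ _
    rw [h1, h2.fderiv, ← hdQ, hs, hs']
    simp only [add_apply, smul_apply, sum_apply, neg_apply, ContinuousLinearMap.comp_apply,
      ContinuousLinearMap.coe_restrictScalars', ContinuousLinearMap.toSpanSingleton_apply,
      Complex.ofRealCLM_apply, smul_eq_mul, ContinuousLinearEquiv.coe_coe, Complex.conjCLE_apply]
    ring
  have hv : ∀ a b : E, Fin.removeNth 0 ![a, b] = fun _ => b := fun a b => by
    funext i; fin_cases i; rfl
  have hv' : ∀ a b : E, Fin.removeNth 1 ![a, b] = fun _ => a := fun a b => by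
    funext i; fin_cases i; rfl
  change Complex.I * extDeriv (del fun z => ((-Real.log (Q z) : ℝ) : ℂ)) z ![w, u] = _
  rw [extDeriv_apply hd, Fin.sum_univ_two]
  simp only [hv, hv', hg, Matrix.cons_val_zero, Matrix.cons_val_one, Fin.val_zero, Fin.val_one]
  have hQ0 : (Q z : ℂ) ≠ 0 := Complex.ofReal_ne_zero.2 (h0 z)
  have hQz : (∑ k, ‖x k z‖ ^ 2 : ℝ) = Q z := rfl
  rw [hQz]
  generalize (Q z : ℂ) = q at hQ0 ⊢
  generalize ∑ k, A k w * conj (x k z) = a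
  generalize ∑ k, A k u * conj (x k z) = b
  simp only [pow_zero, pow_one, one_smul, neg_smul]
  field_simp
  ring

end LogNormSq

/-! ### The Fubini–Study density in an affine chart -/

section Density

variable {ι : Type*} [DecidableEq ι] {j : ι}

theorem affineVec_ne_zero (z : {i : ι // i ≠ j} → ℂ) : affineVec j z ≠ 0 :=
  Function.ne_iff.2 ⟨j, by simp [affineVec]⟩

variable [Fintype ι]

theorem sum_affineVec_mul (z : {i : ι // i ≠ j} → ℂ) (a : ι → ℂ) :
    ∑ i, affineVec j z i * a i = a j + ∑ i : {i : ι // i ≠ j}, z i * a i := by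
  rw [← Finset.add_sum_erase _ _ (Finset.mem_univ j)]
  congr 1
  · simp [affineVec]
  · rw [Finset.sum_subtype (p := (· ≠ j)) (Finset.univ.erase j) (by simp)
      (fun i => affineVec j z i * a i)]
    exact Finset.sum_congr rfl fun i _ => by rw [affineVec, dif_pos i.2]

theorem vecMul_affineVec (R : Matrix ι ι ℂ) (z : {i : ι // i ≠ j} → ℂ) (k : ι) :
    Matrix.vecMul (affineVec j z) R k = R j k + ∑ i : {i : ι // i ≠ j}, z i * R i k :=
  sum_affineVec_mul z fun i => R i k

/-- The squared norm of the row vector `a R`. -/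
def rowNormSq (R : Matrix ι ι ℂ) (a : ι → ℂ) : ℝ := ∑ k, ‖Matrix.vecMul a R k‖ ^ 2

theorem rowNormSq_pos {R : Matrix ι ι ℂ} (hR : R.det ≠ 0) {a : ι → ℂ} (ha : a ≠ 0) :
    0 < rowNormSq R a := by
  have h0 : Matrix.vecMul a R ≠ 0 := fun h => ha (Matrix.eq_zero_of_vecMul_eq_zero hR h)
  obtain ⟨k, hk⟩ := Function.ne_iff.1 h0
  exact Finset.sum_pos' (fun _ _ => by positivity)
    ⟨k, Finset.mem_univ k, by have := norm_pos_iff.2 hk; positivity⟩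

/-- In the chart `x = (1, z) R` is affine in `z`, and the computed two-form is the Gram form of the
components of `A w` and `A u` orthogonal to `x`, divided by `q`. These components are the
combinations of `projRows`, so the two determinant lemmas apply. -/
theorem wedgePow_neg_log_rowNormSq {R : Matrix ι ι ℂ} (hR : R.det ≠ 0)
    (z : {i : ι // i ≠ j} → ℂ) :
    wedgePow (iDelbarDel (fun z => ((-Real.log (rowNormSq R (affineVec j z)) : ℝ) : ℂ)) z)
        (orientedFrame {i : ι // i ≠ j})
      = ((‖R.det‖ ^ 2 / rowNormSq R (affineVec j z) ^ Fintype.card ι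
          * stdWedge {i : ι // i ≠ j} : ℝ) : ℂ) := by
  let A : ι → ({i : ι // i ≠ j} → ℂ) →L[ℂ] ℂ := fun k =>
    ∑ i : {i : ι // i ≠ j}, R i k • ContinuousLinearMap.proj i
  have hA : ∀ k w, A k w = ∑ i : {i : ι // i ≠ j}, w i * R i k := fun k w => by
    simp [A, mul_comm]
  have hx : ∀ k z, HasFDerivAt (fun z => Matrix.vecMul (affineVec j z) R k)
      ((A k).restrictScalars ℝ) z := by
    intro k z
    have : (fun z => Matrix.vecMul (affineVec j z) R k)
        = fun z => R j k + (A k).restrictScalars ℝ z := by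
      funext z
      rw [vecMul_affineVec, ContinuousLinearMap.coe_restrictScalars', hA]
    rw [this]
    exact ((A k).restrictScalars ℝ).hasFDerivAt.const_add _
  have hpos : ∀ z : {i : ι // i ≠ j} → ℂ, 0 < rowNormSq R (affineVec j z) := fun z =>
    rowNormSq_pos hR (affineVec_ne_zero z)
  set x := Matrix.vecMul (affineVec j z) R with hxdef
  set q := rowNormSq R (affineVec j z) with hq
  have hxx : x ⬝ᵥ star x = (q : ℂ) := by
    simp [dotProduct, hq, rowNormSq, Complex.mul_conj', ← hxdef]
  have hq0 : (q : ℂ) ≠ 0 := Complex.ofReal_ne_zero.2 (hpos z).ne'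
  have hvec : ∀ w k, Matrix.vecMul w (projRows j R x) k
      = A k w - (∑ l, A l w * conj (x l)) / q * x k := by
    intro w k
    have h1 : ∑ l, A l w * conj (x l) = ∑ i : {i : ι // i ≠ j}, w i * (R i ⬝ᵥ star x) := by
      simp only [hA, dotProduct, Finset.mul_sum, Finset.sum_mul]
      rw [Finset.sum_comm]
      exact Finset.sum_congr rfl fun i _ => Finset.sum_congr rfl fun l _ => by
        rw [mul_assoc]; rfl
    rw [h1, hA, Finset.sum_div, Finset.sum_mul, ← Finset.sum_sub_distrib]
    refine Finset.sum_congr rfl fun i _ => ?_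
    simp only [projRows, hxx, Pi.sub_apply, Pi.smul_apply, smul_eq_mul]
    ring
  have hdot : ∀ w u, Matrix.vecMul w (projRows j R x) ⬝ᵥ star (Matrix.vecMul u (projRows j R x))
      = ∑ k, A k w * conj (A k u) - (∑ k, A k w * conj (x k)) * conj (∑ k, A k u * conj (x k)) / q
      := by
    intro w u
    have h2 : conj (∑ k, A k u * conj (x k)) = ∑ k, x k * conj (A k u) := by
      simp [mul_comm]
    have h3 : ∀ k, star (Matrix.vecMul u (projRows j R x)) k
        = conj (A k u) - conj (∑ l, A l u * conj (x l)) / q * conj (x k) := by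
      intro k
      rw [Pi.star_apply, hvec]
      simp
    have hxx' : ∑ k, x k * conj (x k) = (q : ℂ) := hxx
    rw [dotProduct]
    simp only [hvec, h3]
    set S := ∑ k, A k w * conj (x k)
    rw [h2]
    set S' := ∑ k, x k * conj (A k u)
    have h4 : ∀ k, (A k w - S / q * x k) * (conj (A k u) - S' / q * conj (x k))
        = A k w * conj (A k u) - S' / q * (A k w * conj (x k)) - S / q * (x k * conj (A k u))
          + S / q * (S' / q) * (x k * conj (x k)) := fun k => by ring
    rw [Finset.sum_congr rfl fun k _ => h4 k, Finset.sum_add_distrib, Finset.sum_sub_distrib,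
      Finset.sum_sub_distrib, ← Finset.mul_sum, ← Finset.mul_sum, ← Finset.mul_sum, hxx']
    change _ - S' / q * S - S / q * S' + _ = _
    field_simp
    ring
  have hω : ∀ w u, iDelbarDel (fun z => ((-Real.log (rowNormSq R (affineVec j z)) : ℝ) : ℂ)) z
      ![w, u] = Complex.I * ((Matrix.vecMul w (projRows j R x)) ⬝ᵥ
        star (Matrix.vecMul u (projRows j R x)) - (Matrix.vecMul u (projRows j R x)) ⬝ᵥ
          star (Matrix.vecMul w (projRows j R x))) / q := by
    intro w u
    rw [hdot, hdot]
    exact iDelbarDel_neg_log_sum_norm_sq hx (fun z => (hpos z).ne') z w u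
  rw [wedgePow_of_gram (projRows j R x) (hpos z) hω]
  have hdet := det_projRows_gram R z hxdef (by rw [hxx]; exact hq0)
  rw [hxx, Complex.mul_conj'] at hdet
  have hcard : Fintype.card {i : ι // i ≠ j} + 1 = Fintype.card ι := by
    have h1 := Fintype.card_subtype_compl (· = j)
    have h2 : 0 < Fintype.card ι := Fintype.card_pos_iff.2 ⟨j⟩
    rw [Fintype.card_subtype_eq] at h1
    simp only [ne_eq]
    omega
  -- The Gram determinant is `|det R|² / q`; this extra `1 / q` raises the exponent from `r - 1` to
  -- `r`, with `r` the number of homogeneous coordinates.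
  rw [eq_div_of_mul_eq hq0 hdet, div_div, ← pow_succ', hcard]
  push_cast
  rfl

end Density

/-! ### Homogeneous coordinates and the integrand -/

section Coordinates

variable {V : Type*} [AddCommGroup V] [Module ℂ V] {r : ℕ}

/-- The functional with homogeneous coordinates `a`. -/
def coordFunctional (b : Module.Basis (Fin r) ℂ V) : (Fin r → ℂ) →ₗ[ℂ] Module.Dual ℂ V where
  toFun a := ∑ i, a i • b.coord i
  map_add' a c := by simp [add_smul, Finset.sum_add_distrib]
  map_smul' t a := by simp [smul_smul, Finset.smul_sum]

theorem coordFunctional_apply (b : Module.Basis (Fin r) ℂ V) (a : Fin r → ℂ) (v : V) :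
    coordFunctional b a v = ∑ i, a i * b.coord i v := by
  simp [coordFunctional]

theorem chartFunctional_eq (b : Module.Basis (Fin r) ℂ V) (j : Fin r)
    (z : {i : Fin r // i ≠ j} → ℂ) :
    chartFunctional b j z = coordFunctional b (affineVec j z) := by
  ext v
  rw [coordFunctional_apply, sum_affineVec_mul z fun i => b.coord i v]
  simp [chartFunctional]

/-- The coordinates of the vectors `e k` with respect to `b`. -/
def coordMatrix (b : Module.Basis (Fin r) ℂ V) (e : Fin r → V) : Matrix (Fin r) (Fin r) ℂ :=
  fun i k => b.coord i (e k)

theorem vecMul_coordMatrix (b : Module.Basis (Fin r) ℂ V) (e : Fin r → V) (a : Fin r → ℂ)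
    (k : Fin r) : Matrix.vecMul a (coordMatrix b e) k = coordFunctional b a (e k) :=
  (coordFunctional_apply b a (e k)).symm

/-- An orthonormal basis, with as many elements as `b`. -/
theorem exists_basis_expansion (b : Module.Basis (Fin r) ℂ V) (h : InnerProductSpace.Core ℂ V) :
    ∃ e : Module.Basis (Fin r) ℂ V, (∀ v : V, ∑ j, herm h v (e j) • e j = v) ∧
      ∀ i k, herm h (e i) (e k) = if i = k then 1 else 0 := by
  have : FiniteDimensional ℂ V := Module.Finite.of_basis b
  let _ : NormedAddCommGroup V := h.toNormedAddCommGroup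
  let _ : InnerProductSpace ℂ V := InnerProductSpace.ofCore h.toCore
  have hr : Module.finrank ℂ V = r := by simpa using Module.finrank_eq_card_basis b
  let e := (stdOrthonormalBasis ℂ V).reindex (finCongr hr)
  refine ⟨e.toBasis, fun v => ?_, fun i k => ?_⟩
  · have := e.sum_repr' v
    simp only [OrthonormalBasis.coe_toBasis]
    exact this
  · have := orthonormal_iff_ite.1 e.orthonormal k i
    simp only [OrthonormalBasis.coe_toBasis]
    refine Eq.trans this ?_
    simp [eq_comm]

theorem det_coordMatrix_ne_zero (b e : Module.Basis (Fin r) ℂ V) :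
    (coordMatrix b e).det ≠ 0 := by
  have : coordMatrix b e = b.toMatrix e := rfl
  rw [this]
  have h1 := b.toMatrix_mul_toMatrix_flip e
  intro h0
  have := congrArg Matrix.det h1
  rw [Matrix.det_mul, h0] at this
  simp at this

variable [FiniteDimensional ℂ V]

theorem dualNorm_coordFunctional (b : Module.Basis (Fin r) ℂ V) {h : InnerProductSpace.Core ℂ V}
    {e : Fin r → V} (he : ∀ v : V, ∑ j, herm h v (e j) • e j = v) (a : Fin r → ℂ) :
    dualNorm h (coordFunctional b a) ^ 2 = rowNormSq (coordMatrix b e) a := by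
  rw [dualNorm_sq h he, rowNormSq]
  simp only [vecMul_coordMatrix]

theorem logHat_eq (b : Module.Basis (Fin r) ℂ V) {h : InnerProductSpace.Core ℂ V}
    {e : Fin r → V} (he : ∀ v : V, ∑ j, herm h v (e j) • e j = v) (j : Fin r) :
    logHat h b j
      = fun z => ((-Real.log (rowNormSq (coordMatrix b e) (affineVec j z)) : ℝ) : ℂ) := by
  funext z
  rw [← dualNorm_coordFunctional b he, ← chartFunctional_eq, logHat, chart, hatOne,
    Projectivization.lift_mk, ← Real.log_inv]
  congr 2
  rw [chartFunctional_self, map_one, one_mul, ← Complex.ofReal_pow, one_div, ← Complex.ofReal_inv,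
    Complex.ofReal_re]

theorem fsIntegrand_eq (b e : Module.Basis (Fin r) ℂ V) {h : InnerProductSpace.Core ℂ V}
    (he : ∀ v : V, ∑ j, herm h v (e j) • e j = v) (F : ℙ ℂ (Module.Dual ℂ V) → ℂ) (j : Fin r)
    (z : {i : Fin r // i ≠ j} → ℂ) :
    fsIntegrand h b F j z = F (chart b j z) *
      ((stdWedge {i : Fin r // i ≠ j} / (r - 1).factorial * (‖(coordMatrix b e).det‖ ^ 2
        / rowNormSq (coordMatrix b e) (affineVec j z) ^ r) : ℝ) : ℂ) := by
  rw [fsIntegrand, fubiniStudy, logHat_eq b he,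
    wedgePow_neg_log_rowNormSq (det_coordMatrix_ne_zero b e), Fintype.card_fin]
  push_cast
  ring

end Coordinates

/-! ### Counting the permutations that match two words -/

section Counting

variable {ι α : Type*} [Fintype ι] [DecidableEq ι] [Fintype α] [DecidableEq α]

/-- The sum counts the `σ` with `q ∘ σ = p`. There are none unless all letters occur equally often
in both words; otherwise they form a coset of the stabilizer of `q`, of order the product of the
factorials of the multiplicities. -/
theorem sum_perm_prod_ite (p q : α → ι) :
    ∑ σ : Equiv.Perm α, ∏ k, (if p k = q (σ k) then (1 : ℂ) else 0)
      = ∏ i, if Fintype.card {k // p k = i} = Fintype.card {k // q k = i}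
          then ((Fintype.card {k // p k = i}).factorial : ℂ) else 0 := by
  have h1 : ∀ σ : Equiv.Perm α, ∏ k, (if p k = q (σ k) then (1 : ℂ) else 0)
      = if q ∘ σ = p then 1 else 0 := by
    intro σ
    rw [Finset.prod_ite_zero]
    simp [funext_iff, eq_comm]
  simp only [h1, Finset.sum_boole]
  rw [← Fintype.card_subtype]
  by_cases h : ∀ i, Fintype.card {k // p k = i} = Fintype.card {k // q k = i}
  · obtain ⟨τ, hτ⟩ : ∃ τ : Equiv.Perm α, q ∘ τ = p :=
      ⟨Equiv.ofFiberEquiv fun i => Fintype.equivOfCardEq (h i),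
        funext fun a => Equiv.ofFiberEquiv_map _ a⟩
    have h2 : Fintype.card {σ : Equiv.Perm α // q ∘ σ = p}
        = Fintype.card {σ : Equiv.Perm α // q ∘ σ = q} := by
      refine Fintype.card_congr ((Equiv.mulRight τ⁻¹).subtypeEquiv fun σ => ?_)
      rw [← hτ]
      constructor
      · intro hσ
        funext k
        simpa using congrFun hσ (τ⁻¹ k)
      · intro hσ
        funext k
        simpa using congrFun hσ (τ k)
    rw [h2, DomMulAct.stabilizer_card]
    push_cast
    exact Finset.prod_congr rfl fun i _ => by rw [if_pos (h i), h i]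
  · push Not at h
    obtain ⟨i, hi⟩ := h
    rw [Finset.prod_eq_zero (Finset.mem_univ i) (if_neg hi)]
    have : IsEmpty {σ : Equiv.Perm α // q ∘ σ = p} := by
      refine ⟨fun ⟨σ, hσ⟩ => hi (Fintype.card_congr (σ.subtypeEquiv fun k => ?_))⟩
      rw [← hσ]
      rfl
    simp

end Counting

/-! ### Gaussian moments -/

section Gaussian

theorem integral_norm_pow_mul_exp (m : ℕ) {q : ℝ} (hq : 0 < q) :
    ∫ t : ℂ, ‖t‖ ^ (2 * m) * Real.exp (-(q * ‖t‖ ^ 2)) = Real.pi * m.factorial / q ^ (m + 1) := by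
  have h := Complex.integral_rpow_mul_exp_neg_mul_rpow (p := 2) (q := (2 * m : ℕ)) (b := q)
    (by norm_num) (lt_of_lt_of_le (by norm_num) (Nat.cast_nonneg _)) hq
  have h1 : (((2 * m : ℕ) : ℝ) + 2) / 2 = m + 1 := by push_cast; ring
  have h2 : -(((2 * m : ℕ) : ℝ) + 2) / 2 = -((m + 1 : ℕ) : ℝ) := by push_cast; ring
  rw [h1, h2, Real.Gamma_nat_eq_factorial, Real.rpow_neg hq.le, Real.rpow_natCast] at h
  simp only [Real.rpow_natCast, Real.rpow_two] at h
  simp only [neg_mul] at h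
  rw [h]
  field_simp

theorem integrable_norm_pow_mul_exp (m : ℕ) {q : ℝ} (hq : 0 < q) :
    Integrable fun t : ℂ => ‖t‖ ^ m * Real.exp (-(q * ‖t‖ ^ 2)) := by
  -- A non-integrable function has integral `0` by convention, so a positive value proves
  -- integrability.
  refine Integrable.of_integral_ne_zero ?_
  have h := Complex.integral_rpow_mul_exp_neg_mul_rpow (p := 2) (q := m) (b := q)
    (by norm_num) (lt_of_lt_of_le (by norm_num) (Nat.cast_nonneg _)) hq
  simp only [Real.rpow_natCast, Real.rpow_two, neg_mul] at h
  rw [h]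
  have : 0 < Real.Gamma ((m + 2) / 2) := Real.Gamma_pos_of_pos (by positivity)
  have := Real.pi_pos
  positivity

theorem integrable_monomial_mul_exp (a b : ℕ) :
    Integrable fun z : ℂ => z ^ a * conj z ^ b * (Real.exp (-‖z‖ ^ 2) : ℂ) := by
  refine (integrable_norm_pow_mul_exp (a + b) one_pos).mono' (by fun_prop)
    (Filter.Eventually.of_forall fun z => le_of_eq ?_)
  rw [norm_mul, norm_mul, norm_pow, norm_pow, RCLike.norm_conj, Complex.norm_real,
    Real.norm_of_nonneg (Real.exp_nonneg _), pow_add, one_mul]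

/-- Rotating by `u` multiplies the integral by `u^a conj(u)^b`; for `a ≠ b` the choice `u = exp(iπ /
(a - b))` makes this factor `-1`. -/
theorem integral_monomial_mul_exp (a b : ℕ) :
    ∫ z : ℂ, z ^ a * conj z ^ b * (Real.exp (-‖z‖ ^ 2) : ℂ)
      = if a = b then (Real.pi : ℂ) * a.factorial else 0 := by
  split_ifs with hab
  · subst hab
    have h := integral_norm_pow_mul_exp a one_pos
    rw [one_pow, div_one] at h
    rw [← Complex.ofReal_natCast, ← Complex.ofReal_mul, ← h, ← integral_complex_ofReal]
    refine integral_congr_ae (Filter.Eventually.of_forall fun z => ?_)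
    simp only
    rw [← mul_pow, Complex.mul_conj']
    push_cast
    rw [one_mul, ← pow_mul]
  · obtain ⟨u, hu⟩ : ∃ u : Circle, (u : ℂ) ^ a * conj (u : ℂ) ^ b ≠ 1 := by
      have hne : (a : ℂ) - b ≠ 0 := sub_ne_zero.2 (Nat.cast_injective.ne hab)
      refine ⟨Circle.exp (Real.pi / ((a : ℝ) - b)), ?_⟩
      have h1 : (Circle.exp (Real.pi / ((a : ℝ) - b)) : ℂ) ^ a
          * conj (Circle.exp (Real.pi / ((a : ℝ) - b)) : ℂ) ^ b = -1 := by
        rw [← Circle.coe_inv_eq_conj, ← Circle.exp_neg, Circle.coe_exp, Circle.coe_exp,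
          ← Complex.exp_nat_mul, ← Complex.exp_nat_mul, ← Complex.exp_add, ← Complex.exp_pi_mul_I]
        congr 1
        push_cast
        field_simp
        ring
      rw [h1]
      norm_num
    set I := ∫ z : ℂ, z ^ a * conj z ^ b * (Real.exp (-‖z‖ ^ 2) : ℂ) with hI
    have h1 : I = (u : ℂ) ^ a * conj (u : ℂ) ^ b * I := by
      have := (rotation u).measurePreserving.integral_comp
        (rotation u).toHomeomorph.measurableEmbedding
        (fun z : ℂ => z ^ a * conj z ^ b * (Real.exp (-‖z‖ ^ 2) : ℂ))
      rw [hI, ← integral_const_mul, ← this]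
      refine integral_congr_ae (Filter.Eventually.of_forall fun z => ?_)
      simp only [rotation_apply, map_mul, norm_mul, Circle.norm_coe, one_mul]
      ring
    have h2 : (1 - (u : ℂ) ^ a * conj (u : ℂ) ^ b) * I = 0 := by
      linear_combination h1
    exact (mul_eq_zero.1 h2).resolve_left fun h3 => hu (sub_eq_zero.1 h3).symm

variable {ι α : Type*} [Fintype ι] [DecidableEq ι] [Fintype α]

theorem prod_monomial_mul_exp (p q : α → ι) (x : ι → ℂ) :
    (∏ k, x (p k)) * conj (∏ k, x (q k)) * (Real.exp (-∑ i, ‖x i‖ ^ 2) : ℂ)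
      = ∏ i, (x i ^ Fintype.card {k // p k = i} * conj (x i) ^ Fintype.card {k // q k = i}
          * (Real.exp (-‖x i‖ ^ 2) : ℂ)) := by
  rw [Finset.prod_mul_distrib, Finset.prod_mul_distrib, map_prod,
    ← Fintype.prod_fiberwise' p x, ← Fintype.prod_fiberwise' q fun i => conj (x i),
    ← Finset.sum_neg_distrib, Real.exp_sum]
  simp

theorem integrable_gaussian_monomial (p q : α → ι) :
    Integrable fun x : ι → ℂ =>
      (∏ k, x (p k)) * conj (∏ k, x (q k)) * (Real.exp (-∑ i, ‖x i‖ ^ 2) : ℂ) := by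
  simp only [prod_monomial_mul_exp]
  exact Integrable.fintype_prod (f := fun (i : ι) (z : ℂ) =>
    z ^ Fintype.card {k // p k = i} * conj z ^ Fintype.card {k // q k = i}
      * (Real.exp (-‖z‖ ^ 2) : ℂ)) fun i => integrable_monomial_mul_exp _ _

/-- Fubini reduces to one variable at a time. Multiplicities must agree, and each variable then
contributes `π` times a factorial: the same product that counts matching permutations. -/
theorem integral_gaussian_monomial [DecidableEq α] (p q : α → ι) :
    ∫ x : ι → ℂ, (∏ k, x (p k)) * conj (∏ k, x (q k)) * (Real.exp (-∑ i, ‖x i‖ ^ 2) : ℂ)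
      = (Real.pi : ℂ) ^ Fintype.card ι
        * ∑ σ : Equiv.Perm α, ∏ k, (if p k = q (σ k) then (1 : ℂ) else 0) := by
  simp only [prod_monomial_mul_exp]
  rw [integral_fintype_prod_volume_eq_prod (fun (i : ι) (z : ℂ) =>
    z ^ Fintype.card {k // p k = i} * conj z ^ Fintype.card {k // q k = i}
      * (Real.exp (-‖z‖ ^ 2) : ℂ)), sum_perm_prod_ite]
  simp only [integral_monomial_mul_exp]
  rw [← Finset.card_univ, ← Finset.prod_const, ← Finset.prod_mul_distrib]
  exact Finset.prod_congr rfl fun i _ => by split_ifs <;> simp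

end Gaussian

/-! ### Linear changes of variables and integration along the lines through the origin -/

section ChangeOfVariables

theorem measurableEmbedding_toLinearMap {ι : Type*} [Fintype ι] (f : (ι → ℂ) →ₗ[ℂ] (ι → ℂ))
    (hf : LinearMap.det f ≠ 0) : MeasurableEmbedding f := by
  exact (f.equivOfDetNeZero hf).toContinuousLinearEquiv.toHomeomorph.measurableEmbedding

theorem map_complexLinearMap_volume {ι : Type*} [Fintype ι] (f : (ι → ℂ) →ₗ[ℂ] (ι → ℂ))
    (hf : LinearMap.det f ≠ 0) :
    Measure.map f volume = ENNReal.ofReal (‖LinearMap.det f‖ ^ 2)⁻¹ • volume := by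
  have hdet : LinearMap.det (f.restrictScalars ℝ) = ‖LinearMap.det f‖ ^ 2 := by
    rw [LinearMap.det_restrictScalars, Algebra.norm_complex_apply, Complex.normSq_eq_norm_sq]
  have h0 : LinearMap.det (f.restrictScalars ℝ) ≠ 0 := by
    rw [hdet]; have := norm_pos_iff.2 hf; positivity
  have := Measure.map_linearMap_addHaar_eq_smul_addHaar (volume : Measure (ι → ℂ)) h0
  rw [hdet, abs_of_nonneg (by positivity)] at this
  exact this

theorem integrable_comp_vecMul {ι : Type*} [Fintype ι] [DecidableEq ι] {R : Matrix ι ι ℂ}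
    (hR : R.det ≠ 0) {g : (ι → ℂ) → ℂ} (hg : Integrable g) :
    Integrable (fun a => g (Matrix.vecMul a R)) ∧
      ∫ a, g (Matrix.vecMul a R) = ((‖R.det‖ ^ 2)⁻¹ : ℝ) * ∫ a, g a := by
  set f := Matrix.toLin' R.transpose with hf
  have hdet : LinearMap.det f = R.det := by rw [hf, LinearMap.det_toLin', Matrix.det_transpose]
  have hfa : ∀ a, Matrix.vecMul a R = f a := fun a => by
    rw [hf, Matrix.toLin'_apply, Matrix.mulVec_transpose]
  have hf0 : LinearMap.det f ≠ 0 := by rwa [hdet]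
  have hmap := map_complexLinearMap_volume f hf0
  have hemb := measurableEmbedding_toLinearMap f hf0
  simp only [hfa]
  refine ⟨?_, ?_⟩
  · refine (hemb.integrable_map_iff (g := g)).1 ?_
    rw [hmap]
    exact hg.smul_measure ENNReal.ofReal_ne_top
  · rw [← hemb.integral_map g, hmap, integral_smul_measure, hdet,
      ENNReal.toReal_ofReal (by positivity)]
    simp

variable {ι : Type*} [DecidableEq ι] (j : ι)

/-- Insert the `j`-th coordinate. -/
def insertCoord (p : ℂ × ({i : ι // i ≠ j} → ℂ)) (i : ι) : ℂ :=
  if h : i ≠ j then p.2 ⟨i, h⟩ else p.1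

theorem smul_affineVec (t : ℂ) (z : {i : ι // i ≠ j} → ℂ) :
    t • affineVec j z = insertCoord j (t, t • z) := by
  ext i
  by_cases h : i = j <;> simp [affineVec, insertCoord, h]

theorem continuous_affineVec : Continuous (affineVec j) := by
  refine continuous_pi fun i => ?_
  by_cases h : i = j <;> simp only [affineVec, h, ne_eq, not_true_eq_false, not_false_eq_true,
    dite_true, dite_false] <;> fun_prop

variable [Fintype ι]

theorem measurePreserving_insertCoord : MeasurePreserving (insertCoord j) := by
  have h1 := (volume_preserving_piEquivPiSubtypeProd (fun _ : ι => ℂ) (· = j)).symm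
  -- The product measure carries a `Fintype` instance on the singleton index type; quantifying over
  -- it reconciles the instances of the two equivalences.
  have h0 : ∀ [Fintype {i : ι // i = j}],
      MeasurePreserving (MeasurableEquiv.funUnique {i : ι // i = j} ℂ).symm := by
    intro F
    obtain rfl : F = Unique.fintype := Subsingleton.elim _ _
    exact (volume_preserving_funUnique {i : ι // i = j} ℂ).symm
  have h2 := (@h0 (Subtype.fintype _)).prod
    (MeasurePreserving.id (volume : Measure ({i : ι // ¬ i = j} → ℂ)))
  have h3 := h1.comp (by exact h2)
  convert h3 using 1
  · ext p i
    by_cases h : i = j <;>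
      simp [insertCoord, h, MeasurableEquiv.piEquivPiSubtypeProd, Equiv.piEquivPiSubtypeProd]
  · rfl

theorem lintegral_comp_complex_smul {κ : Type*} [Fintype κ] {t : ℂ} (ht : t ≠ 0)
    {g : (κ → ℂ) → ENNReal} (hg : Measurable g) :
    ENNReal.ofReal (‖t‖ ^ (2 * Fintype.card κ)) * ∫⁻ z, g (t • z) = ∫⁻ z, g z := by
  set f : (κ → ℂ) →ₗ[ℂ] (κ → ℂ) := t • LinearMap.id with hf
  have hdet : LinearMap.det f = t ^ Fintype.card κ := by
    rw [hf, LinearMap.det_smul, LinearMap.det_id, mul_one, Module.finrank_pi]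
  have hf0 : LinearMap.det f ≠ 0 := by rw [hdet]; exact pow_ne_zero _ ht
  have h1 : ∫⁻ z, g (t • z) = ∫⁻ z, g z ∂(Measure.map f volume) := by
    rw [lintegral_map hg (measurableEmbedding_toLinearMap f hf0).measurable]
    rfl
  have hpos : 0 < ‖t‖ ^ (2 * Fintype.card κ) := by have := norm_pos_iff.2 ht; positivity
  rw [h1, map_complexLinearMap_volume f hf0, lintegral_smul_measure, hdet, norm_pow, ← pow_mul,
    mul_comm (Fintype.card κ), smul_eq_mul, ← mul_assoc, ← ENNReal.ofReal_mul hpos.le,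
    mul_inv_cancel₀ hpos.ne', ENNReal.ofReal_one, one_mul]

/-- For fixed `t ≠ 0` the map `z ↦ t z` has real Jacobian `|t|^{2n}`, where `n` is the number of
affine coordinates; the slice `t = 0` is null. -/
theorem measurePreserving_smul_affineVec :
    MeasurePreserving (fun p : ℂ × ({i : ι // i ≠ j} → ℂ) => p.1 • affineVec j p.2)
      ((volume.prod volume).withDensity
        fun p => ENNReal.ofReal (‖p.1‖ ^ (2 * Fintype.card {i : ι // i ≠ j}))) volume := by
  have hm : Measurable (fun p : ℂ × ({i : ι // i ≠ j} → ℂ) => p.1 • affineVec j p.2) :=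
    (continuous_fst.smul ((continuous_affineVec j).comp continuous_snd)).measurable
  have hd : Measurable (fun p : ℂ × ({i : ι // i ≠ j} → ℂ) =>
      ENNReal.ofReal (‖p.1‖ ^ (2 * Fintype.card {i : ι // i ≠ j}))) := by fun_prop
  refine ⟨hm, Measure.ext_of_lintegral _ fun g hg => ?_⟩
  have hi := measurePreserving_insertCoord j
  rw [lintegral_map hg hm]
  refine (lintegral_withDensity_eq_lintegral_mul _ hd (hg.comp hm)).trans ?_
  rw [← hi.lintegral_comp hg]
  change ∫⁻ p, _ ∂(volume.prod volume) = ∫⁻ p, _ ∂(volume.prod volume)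
  rw [lintegral_prod _ (hd.mul (hg.comp hm)).aemeasurable,
    lintegral_prod (fun p => g (insertCoord j p)) (hg.comp hi.measurable).aemeasurable]
  refine lintegral_congr_ae ?_
  have hne : ∀ᵐ t : ℂ, t ≠ 0 := by simp [ae_iff]
  filter_upwards [hne] with t ht
  simp only [Pi.mul_apply]
  rw [lintegral_const_mul' _ _ ENNReal.ofReal_ne_top]
  simp only [smul_affineVec]
  exact lintegral_comp_complex_smul ht
    (g := fun w => g (insertCoord j (t, w))) (hg.comp (hi.measurable.comp measurable_prodMk_left))

variable {j} in
/-- Integration in homogeneous coordinates. -/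
theorem integral_cone {Φ : (ι → ℂ) → ℂ} {q : (ι → ℂ) → ℝ} {m : ℕ}
    (hΦ : ∀ (t : ℂ) a, Φ (t • a) = ((‖t‖ ^ (2 * m) : ℝ) : ℂ) * Φ a)
    (hq : ∀ (t : ℂ) a, q (t • a) = ‖t‖ ^ 2 * q a) (hpos : ∀ a, a ≠ 0 → 0 < q a)
    (hint : Integrable fun a => Φ a * (Real.exp (-q a) : ℂ)) :
    Integrable (fun z => Φ (affineVec j z)
        * (((q (affineVec j z) ^ (Fintype.card ι + m))⁻¹ : ℝ) : ℂ)) ∧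
      ∫ a, Φ a * (Real.exp (-q a) : ℂ) = ((Real.pi * (Fintype.card ι + m - 1).factorial : ℝ) : ℂ)
        * ∫ z, Φ (affineVec j z) * (((q (affineVec j z) ^ (Fintype.card ι + m))⁻¹ : ℝ) : ℂ) := by
  set n := Fintype.card {i : ι // i ≠ j} with hn
  have hcard : n + 1 = Fintype.card ι := by
    have h1 := Fintype.card_subtype_compl (· = j)
    have h2 : 0 < Fintype.card ι := Fintype.card_pos_iff.2 ⟨j⟩
    rw [Fintype.card_subtype_eq] at h1
    simp only [hn, ne_eq]
    omega
  have hN : Fintype.card ι + m = (n + m) + 1 := by omega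
  rw [hN, Nat.add_sub_cancel]
  have hd : Measurable (fun p : ℂ × ({i : ι // i ≠ j} → ℂ) =>
      ENNReal.ofReal (‖p.1‖ ^ (2 * n))) := by fun_prop
  have hlt : ∀ᵐ p : ℂ × ({i : ι // i ≠ j} → ℂ) ∂(volume.prod volume),
      ENNReal.ofReal (‖p.1‖ ^ (2 * n)) < ⊤ := Filter.Eventually.of_forall fun p =>
    ENNReal.ofReal_lt_top
  have hmp := measurePreserving_smul_affineVec j
  have hrw : ∀ p : ℂ × ({i : ι // i ≠ j} → ℂ), (ENNReal.ofReal (‖p.1‖ ^ (2 * n))).toReal •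
      (Φ (p.1 • affineVec j p.2) * (Real.exp (-q (p.1 • affineVec j p.2)) : ℂ))
      = Φ (affineVec j p.2) * ((‖p.1‖ ^ (2 * (n + m))
        * Real.exp (-(q (affineVec j p.2) * ‖p.1‖ ^ 2)) : ℝ) : ℂ) := by
    intro p
    rw [ENNReal.toReal_ofReal (by positivity), Complex.real_smul, hΦ, hq,
      mul_comm (q (affineVec j p.2))]
    push_cast
    ring
  have hint' : Integrable (fun p : ℂ × ({i : ι // i ≠ j} → ℂ) => Φ (affineVec j p.2)
      * ((‖p.1‖ ^ (2 * (n + m)) * Real.exp (-(q (affineVec j p.2) * ‖p.1‖ ^ 2)) : ℝ) : ℂ))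
      (volume.prod volume) := by
    have := (hmp.integrable_comp hint.aestronglyMeasurable).2 hint
    rw [integrable_withDensity_iff_integrable_smul' hd hlt] at this
    simpa only [Function.comp_def, hrw] using this
  -- The Jacobian supplies `|t|^{2n}` and homogeneity of `Φ` supplies `|t|^{2m}`, leaving a
  -- one-variable Gaussian moment of order `n + m`.
  have hinner : ∀ z : {i : ι // i ≠ j} → ℂ, ∫ t : ℂ, Φ (affineVec j z)
      * ((‖t‖ ^ (2 * (n + m)) * Real.exp (-(q (affineVec j z) * ‖t‖ ^ 2)) : ℝ) : ℂ)
      = ((Real.pi * (n + m).factorial : ℝ) : ℂ)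
        * (Φ (affineVec j z) * (((q (affineVec j z) ^ (n + m + 1))⁻¹ : ℝ) : ℂ)) := by
    intro z
    rw [integral_const_mul, integral_complex_ofReal,
      integral_norm_pow_mul_exp _ (hpos _ (affineVec_ne_zero z)), div_eq_mul_inv]
    push_cast
    ring
  have hc : ((Real.pi * (n + m).factorial : ℝ) : ℂ) ≠ 0 :=
    Complex.ofReal_ne_zero.2 (by have := Real.pi_pos; positivity)
  refine ⟨?_, ?_⟩
  · have := hint'.integral_prod_right
    simp only [hinner] at this
    exact (integrable_const_mul_iff hc.isUnit _).1 this
  · have h1 : ∫ a, Φ a * (Real.exp (-q a) : ℂ)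
        = ∫ p : ℂ × ({i : ι // i ≠ j} → ℂ), (ENNReal.ofReal (‖p.1‖ ^ (2 * n))).toReal •
          (Φ (p.1 • affineVec j p.2) * (Real.exp (-q (p.1 • affineVec j p.2)) : ℂ))
            ∂(volume.prod volume) := by
      rw [← hmp.map_eq, integral_map hmp.measurable.aemeasurable
        (hmp.map_eq.symm ▸ hint.aestronglyMeasurable),
        integral_withDensity_eq_integral_toReal_smul hd hlt]
    rw [h1]
    simp only [hrw]
    rw [integral_prod_symm _ hint']
    simp only [hinner]
    rw [integral_const_mul]

end ChangeOfVariables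

/-! ### The Gaussian pairing reproduces `Sym^d h` -/

section GaussianPairing

variable {V : Type*} [AddCommGroup V] [Module ℂ V] [FiniteDimensional ℂ V] {r d : ℕ}

/-- The function `a ↦ f^{⊗d}(v) conj(f^{⊗d}(w))`, where `f` has the homogeneous coordinates `a`. -/
def powPairing (b : Module.Basis (Fin r) ℂ V) (v w : SymPow d V) (a : Fin r → ℂ) : ℂ :=
  powFunctional d (coordFunctional b a) v * conj (powFunctional d (coordFunctional b a) w)

omit [FiniteDimensional ℂ V] in
theorem powPairing_smul (b : Module.Basis (Fin r) ℂ V) (v w : SymPow d V) (t : ℂ)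
    (a : Fin r → ℂ) :
    powPairing b v w (t • a) = ((‖t‖ ^ (2 * d) : ℝ) : ℂ) * powPairing b v w a := by
  have : ((‖t‖ ^ (2 * d) : ℝ) : ℂ) = t ^ d * conj (t ^ d) := by
    rw [Complex.mul_conj', norm_pow]
    push_cast
    rw [← pow_mul, mul_comm d]
  rw [this, powPairing, powPairing, map_smul, powFunctional_smul]
  simp only [LinearMap.smul_apply, smul_eq_mul, map_mul]
  ring

theorem continuous_powFunctional (b : Module.Basis (Fin r) ℂ V) (h : InnerProductSpace.Core ℂ V)
    (s : SymPow d V) : Continuous fun a => powFunctional d (coordFunctional b a) s := by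
  obtain ⟨n, e, he⟩ := exists_orthonormal_expansion h
  rw [← symForm_expansion h he s]
  simp only [map_sum, map_smul, powFunctional_symMk, coordFunctional_apply]
  fun_prop

/-- Both sides are sesquilinear, so products of the `e k` suffice. On these the pairing is a
monomial in `a R`, and its moment is `d!` times the normalized permutation sum of `Sym^d h`. -/
theorem gaussian_powPairing (b e : Module.Basis (Fin r) ℂ V) {h : InnerProductSpace.Core ℂ V}
    (he : ∀ v : V, ∑ j, herm h v (e j) • e j = v)
    (hon : ∀ i k, herm h (e i) (e k) = if i = k then 1 else 0) (v w : SymPow d V) :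
    Integrable (fun a => powPairing b v w a * (Real.exp (-rowNormSq (coordMatrix b e) a) : ℂ)) ∧
      ∫ a, powPairing b v w a * (Real.exp (-rowNormSq (coordMatrix b e) a) : ℂ)
        = (((‖(coordMatrix b e).det‖ ^ 2)⁻¹ * (Real.pi ^ r * d.factorial) : ℝ) : ℂ)
          * herm (symInner d h) v w := by
  set R := coordMatrix b e with hRdef
  have hR : R.det ≠ 0 := det_coordMatrix_ne_zero b e
  set c := (((‖R.det‖ ^ 2)⁻¹ * (Real.pi ^ r * d.factorial) : ℝ) : ℂ) with hc
  let E : (Fin d → Fin r) → SymPow d V := fun p => symMk fun k => e (p k)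
  have hmon : ∀ p p' : Fin d → Fin r,
      Integrable (fun a => powPairing b (E p) (E p') a * (Real.exp (-rowNormSq R a) : ℂ)) ∧
      ∫ a, powPairing b (E p) (E p') a * (Real.exp (-rowNormSq R a) : ℂ)
        = c * symForm d h (E p) (E p') := by
    intro p p'
    have h1 := integrable_comp_vecMul hR (integrable_gaussian_monomial p p')
    have h2 : ∀ a, powPairing b (E p) (E p') a * (Real.exp (-rowNormSq R a) : ℂ)
        = (∏ k, Matrix.vecMul a R (p k)) * conj (∏ k, Matrix.vecMul a R (p' k))
          * (Real.exp (-∑ i, ‖Matrix.vecMul a R i‖ ^ 2) : ℂ) := by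
      intro a
      simp only [powPairing, E, powFunctional_symMk, hRdef, vecMul_coordMatrix, rowNormSq]
    simp only [h2]
    refine ⟨h1.1, h1.2.trans ?_⟩
    rw [integral_gaussian_monomial, symForm_symMk, Fintype.card_fin]
    simp only [hon]
    have : (d.factorial : ℂ) ≠ 0 := by exact_mod_cast d.factorial_ne_zero
    rw [hc]
    push_cast
    field_simp
  have hsum : ∀ (x y : (Fin d → Fin r) → ℂ) a,
      powPairing b (∑ p, x p • E p) (∑ p, y p • E p) a * (Real.exp (-rowNormSq R a) : ℂ)
        = ∑ p, ∑ p', x p * conj (y p') *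
          (powPairing b (E p) (E p') a * (Real.exp (-rowNormSq R a) : ℂ)) := by
    intro x y a
    simp only [powPairing, map_sum, map_smul, smul_eq_mul, map_mul]
    rw [Finset.sum_mul_sum, Finset.sum_mul]
    refine Finset.sum_congr rfl fun p _ => ?_
    rw [Finset.sum_mul]
    exact Finset.sum_congr rfl fun p' _ => by ring
  change _ ∧ _ = c * symForm d h v w
  obtain ⟨x, hx⟩ : ∃ x : (Fin d → Fin r) → ℂ, ∑ p, x p • E p = v :=
    ⟨_, symForm_expansion h he v⟩
  obtain ⟨y, hy⟩ : ∃ y : (Fin d → Fin r) → ℂ, ∑ p, y p • E p = w :=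
    ⟨_, symForm_expansion h he w⟩
  rw [← hx, ← hy]
  simp only [hsum]
  have hint : ∀ p p', Integrable (fun a => x p * conj (y p') *
      (powPairing b (E p) (E p') a * (Real.exp (-rowNormSq R a) : ℂ))) := fun p p' =>
    (hmon p p').1.const_mul _
  refine ⟨integrable_finsetSum _ fun p _ => integrable_finsetSum _ fun p' _ => hint p p', ?_⟩
  rw [integral_finsetSum _ fun p _ => integrable_finsetSum _ fun p' _ => hint p p']
  simp only [map_sum, LinearMap.sum_apply, map_smul, LinearMap.smul_apply, map_smulₛₗ,
    smul_eq_mul, Finset.mul_sum]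
  rw [Finset.sum_comm]
  refine Finset.sum_congr rfl fun p _ => ?_
  rw [integral_finsetSum _ fun p' _ => hint p p']
  refine Finset.sum_congr rfl fun p' _ => ?_
  rw [integral_const_mul, (hmon p p').2]
  ring

omit [FiniteDimensional ℂ V] in
theorem rowNormSq_smul (R : Matrix (Fin r) (Fin r) ℂ) (t : ℂ) (a : Fin r → ℂ) :
    rowNormSq R (t • a) = ‖t‖ ^ 2 * rowNormSq R a := by
  simp [rowNormSq, Matrix.smul_vecMul, mul_pow, Finset.mul_sum]

/-- The pairing of `Sym^d V`, integrated over an affine chart. -/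
theorem chart_powPairing (j : Fin r) (b e : Module.Basis (Fin r) ℂ V)
    {h : InnerProductSpace.Core ℂ V} (he : ∀ v : V, ∑ j, herm h v (e j) • e j = v)
    (hon : ∀ i k, herm h (e i) (e k) = if i = k then 1 else 0) (v w : SymPow d V) :
    Integrable (fun z => powPairing b v w (affineVec j z)
        * (((rowNormSq (coordMatrix b e) (affineVec j z) ^ (r + d))⁻¹ : ℝ) : ℂ)) ∧
      ∫ z, powPairing b v w (affineVec j z)
        * (((rowNormSq (coordMatrix b e) (affineVec j z) ^ (r + d))⁻¹ : ℝ) : ℂ)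
        = (((‖(coordMatrix b e).det‖ ^ 2)⁻¹ * (Real.pi ^ r * d.factorial
            / (Real.pi * (r + d - 1).factorial)) : ℝ) : ℂ) * herm (symInner d h) v w := by
  obtain ⟨h1, h2⟩ := gaussian_powPairing b e he hon v w
  have h3 := integral_cone (j := j) (powPairing_smul b v w) (rowNormSq_smul (coordMatrix b e))
    (fun a ha => rowNormSq_pos (det_coordMatrix_ne_zero b e) ha) h1
  rw [Fintype.card_fin] at h3
  refine ⟨h3.1, ?_⟩
  have hc : ((Real.pi * (r + d - 1).factorial : ℝ) : ℂ) ≠ 0 :=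
    Complex.ofReal_ne_zero.2 (by have := Real.pi_pos; positivity)
  apply mul_left_cancel₀ hc
  rw [← h3.2, h2]
  conv_rhs => rw [← mul_assoc, ← Complex.ofReal_mul]
  congr 2
  have := Real.pi_pos
  field_simp

omit [FiniteDimensional ℂ V] in
theorem chart_volume (j : Fin r) (b e : Module.Basis (Fin r) ℂ V) :
    Integrable (fun z => (rowNormSq (coordMatrix b e) (affineVec j z) ^ r)⁻¹) ∧
      ∫ z, (rowNormSq (coordMatrix b e) (affineVec j z) ^ r)⁻¹
        = (‖(coordMatrix b e).det‖ ^ 2)⁻¹ * (Real.pi ^ r / (Real.pi * (r - 1).factorial)) := by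
  set R := coordMatrix b e with hRdef
  have hR : R.det ≠ 0 := det_coordMatrix_ne_zero b e
  -- The empty word gives the pure Gaussian integral.
  have h1 := integrable_comp_vecMul hR (integrable_gaussian_monomial (α := Fin 0)
    (Fin.elim0 : Fin 0 → Fin r) Fin.elim0)
  rw [integral_gaussian_monomial] at h1
  simp only [Finset.univ_eq_empty, Finset.prod_empty, map_one, one_mul, Finset.sum_const,
    Finset.card_univ, Fintype.card_unique, one_smul, mul_one, Fintype.card_fin] at h1
  have h3 := integral_cone (j := j) (Φ := fun _ => 1) (m := 0) (by simp) (rowNormSq_smul R)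
    (fun a ha => rowNormSq_pos hR ha) (by simp only [one_mul]; exact h1.1)
  simp only [one_mul, Fintype.card_fin, add_zero] at h3
  have hint : Integrable (fun z => (rowNormSq R (affineVec j z) ^ r)⁻¹) := h3.1.re
  refine ⟨hint, ?_⟩
  have h4 := h3.2.symm.trans h1.2
  rw [integral_complex_ofReal] at h4
  have hc : Real.pi * (r - 1).factorial ≠ 0 := by have := Real.pi_pos; positivity
  apply mul_left_cancel₀ hc
  apply Complex.ofReal_injective
  push_cast at h4 ⊢
  rw [h4]
  have := Real.pi_pos
  have h5 : (Real.pi : ℂ) ≠ 0 := Complex.ofReal_ne_zero.2 this.ne'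
  have h6 : ((r - 1).factorial : ℂ) ≠ 0 := by exact_mod_cast Nat.factorial_ne_zero _
  field_simp

end GaussianPairing

/-! ### Only the first chart has positive measure -/

section Pieces

variable {V : Type*} [AddCommGroup V] [Module ℂ V] {r : ℕ} (h : InnerProductSpace.Core ℂ V)
  (b : Module.Basis (Fin r) ℂ V) (F : ℙ ℂ (Module.Dual ℂ V) → ℂ) {j₀ : Fin r}

/-- A later piece lies in the coordinate hyperplane where the `j₀`-th coordinate vanishes. -/
theorem volume_chartPiece_eq_zero {j : Fin r} (hj : j₀ < j) : volume (chartPiece r j) = 0 := by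
  refine measure_mono_null (t := {z | z ⟨j₀, hj.ne⟩ = 0}) (fun z hz => hz ⟨j₀, hj.ne⟩ hj) ?_
  exact Measure.pi_hyperplane (fun _ : {i : Fin r // i ≠ j} => (volume : Measure ℂ)) _ 0

theorem chartPiece_eq_univ (h0 : ∀ j, j₀ ≤ j) : chartPiece r j₀ = Set.univ :=
  Set.eq_univ_of_forall fun _ i hi => absurd hi (not_lt.2 (h0 i))

theorem fsIntegrable_iff (h0 : ∀ j, j₀ ≤ j) :
    FSIntegrable h b F ↔ Integrable (fsIntegrand h b F j₀) := by
  constructor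
  · intro hF
    have := hF j₀
    rwa [chartPiece_eq_univ h0, integrableOn_univ] at this
  · intro hF j
    rcases (h0 j).eq_or_lt with rfl | hj
    · exact hF.integrableOn
    · rw [IntegrableOn, Measure.restrict_eq_zero.2 (volume_chartPiece_eq_zero hj)]
      exact integrable_zero_measure

theorem fsIntegral_eq (h0 : ∀ j, j₀ ≤ j) :
    fsIntegral h b F = ∫ z, fsIntegrand h b F j₀ z := by
  rw [fsIntegral, Finset.sum_eq_single j₀, chartPiece_eq_univ h0, Measure.restrict_univ]
  · intro j _ hj
    rw [Measure.restrict_eq_zero.2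
      (volume_chartPiece_eq_zero ((h0 j).lt_of_ne (Ne.symm hj))), integral_zero_measure]
  · simp

end Pieces

/-! ### Integrability and comparison of the integrals -/

section Estimates

variable {V : Type*} [AddCommGroup V] [Module ℂ V] [FiniteDimensional ℂ V] {r d : ℕ}

omit [FiniteDimensional ℂ V] in
theorem hatPow_chart (H : InnerProductSpace.Core ℂ (SymPow d V)) (b : Module.Basis (Fin r) ℂ V)
    (j : Fin r) (v w : SymPow d V) (z : {i : Fin r // i ≠ j} → ℂ) :
    hatPow H v w (chart b j z) = powPairing b v w (affineVec j z)
      * (((dualNorm H (powFunctional d (coordFunctional b (affineVec j z))) ^ 2)⁻¹ : ℝ) : ℂ) := by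
  rw [powPairing, ← chartFunctional_eq, chart, hatPow, Projectivization.lift_mk, div_eq_mul_inv]
  push_cast
  rfl

theorem norm_powPairing_le (H : InnerProductSpace.Core ℂ (SymPow d V))
    (b : Module.Basis (Fin r) ℂ V) (v w : SymPow d V) (a : Fin r → ℂ) :
    ‖powPairing b v w a‖ ≤ dualNorm H (powFunctional d (coordFunctional b a)) ^ 2
      * (hermNorm H v * hermNorm H w) := by
  rw [powPairing, norm_mul, RCLike.norm_conj]
  refine (mul_le_mul (norm_apply_le_dualNorm H _ v) (norm_apply_le_dualNorm H _ w)
    (norm_nonneg _) (mul_nonneg (dualNorm_nonneg H _) (hermNorm_nonneg H v))).trans_eq ?_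
  ring

theorem norm_hatPow_chart_le (H : InnerProductSpace.Core ℂ (SymPow d V))
    (b : Module.Basis (Fin r) ℂ V) (j : Fin r) (v w : SymPow d V)
    (z : {i : Fin r // i ≠ j} → ℂ) :
    ‖hatPow H v w (chart b j z)‖ ≤ hermNorm H v * hermNorm H w := by
  have h1 := norm_powPairing_le H b v w (affineVec j z)
  rw [hatPow_chart, norm_mul, Complex.norm_real, Real.norm_of_nonneg (by positivity)]
  set D := dualNorm H (powFunctional d (coordFunctional b (affineVec j z))) ^ 2
  have hN : 0 ≤ hermNorm H v * hermNorm H w :=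
    mul_nonneg (hermNorm_nonneg H v) (hermNorm_nonneg H w)
  calc _ ≤ (D * (hermNorm H v * hermNorm H w)) * D⁻¹ :=
        mul_le_mul_of_nonneg_right h1 (by positivity)
    _ = (D * D⁻¹) * (hermNorm H v * hermNorm H w) := by ring
    -- With `0⁻¹ = 0` this needs no proof that `D` is nonzero.
    _ ≤ 1 * (hermNorm H v * hermNorm H w) := mul_le_mul_of_nonneg_right mul_inv_le_one hN
    _ = _ := one_mul _

/-- The numerator is at most `|f^{⊗d}|_S² |v|_S |w|_S`, and this dual norm cancels against the
relative error `δ` of its inverse square. -/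
theorem norm_hatPow_chart_sub_le (H S : InnerProductSpace.Core ℂ (SymPow d V))
    (hδ : hermDist H S < 1) (b : Module.Basis (Fin r) ℂ V) (j : Fin r) (v w : SymPow d V)
    (z : {i : Fin r // i ≠ j} → ℂ) :
    ‖hatPow H v w (chart b j z) - hatPow S v w (chart b j z)‖
      ≤ hermDist H S * (hermNorm S v * hermNorm S w) := by
  have h1 := norm_powPairing_le S b v w (affineVec j z)
  have h2 := abs_inv_dualNorm_sq_sub_le H S hδ
    (powFunctional d (coordFunctional b (affineVec j z)))
  rw [hatPow_chart, hatPow_chart, ← mul_sub, ← Complex.ofReal_sub, norm_mul, Complex.norm_real,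
    Real.norm_eq_abs]
  set D := dualNorm S (powFunctional d (coordFunctional b (affineVec j z))) ^ 2
  have hD : 0 ≤ D := by positivity
  have hδ0 := hermDist_nonneg H S
  have hN : 0 ≤ hermNorm S v * hermNorm S w :=
    mul_nonneg (hermNorm_nonneg S v) (hermNorm_nonneg S w)
  calc _ ≤ (D * (hermNorm S v * hermNorm S w)) * (hermDist H S * D⁻¹) :=
        mul_le_mul h1 h2 (abs_nonneg _) (by positivity)
    _ = (D * D⁻¹) * (hermDist H S * (hermNorm S v * hermNorm S w)) := by ring
    _ ≤ 1 * (hermDist H S * (hermNorm S v * hermNorm S w)) :=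
        mul_le_mul_of_nonneg_right (mul_inv_le_one) (by positivity)
    _ = _ := one_mul _

/-- By Parseval for `H` the squared dual norm is a finite sum of squared moduli of continuous
functions. -/
theorem measurable_hatPow_chart (H : InnerProductSpace.Core ℂ (SymPow d V))
    (h : InnerProductSpace.Core ℂ V) (b : Module.Basis (Fin r) ℂ V) (j : Fin r)
    (v w : SymPow d V) : Measurable fun z => hatPow H v w (chart b j z) := by
  obtain ⟨n, E, hE⟩ := exists_orthonormal_expansion H
  have hc : ∀ s : SymPow d V,
      Measurable fun z => powFunctional d (coordFunctional b (affineVec j z)) s := fun s =>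
    ((continuous_powFunctional b h s).comp (continuous_affineVec j)).measurable
  simp only [hatPow_chart, dualNorm_sq H hE, powPairing]
  refine ((hc v).mul (Complex.continuous_conj.measurable.comp (hc w))).mul
    (Complex.measurable_ofReal.comp ?_)
  exact (Finset.measurable_fun_sum _ fun k _ => (hc (E k)).norm.pow_const 2).inv

/-- The density of `ω_{FS,h}^{r-1} / (r-1)!` in an affine chart. -/
def fsDensity (b : Module.Basis (Fin r) ℂ V) (e : Fin r → V) (j : Fin r)
    (z : {i : Fin r // i ≠ j} → ℂ) : ℝ :=
  stdWedge {i : Fin r // i ≠ j} / (r - 1).factorial * (‖(coordMatrix b e).det‖ ^ 2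
    / rowNormSq (coordMatrix b e) (affineVec j z) ^ r)

omit [FiniteDimensional ℂ V] in
-- The factor `|det R|²` cancels that of the chart volume, so the total mass is the same for every
-- `V`, `h` and basis.
theorem integrable_fsDensity (b e : Module.Basis (Fin r) ℂ V) (j : Fin r) :
    Integrable (fsDensity b e j) ∧ ∫ z, ‖fsDensity b e j z‖
      = |stdWedge {i : Fin r // i ≠ j}| / (r - 1).factorial
        * (Real.pi ^ r / (Real.pi * (r - 1).factorial)) := by
  obtain ⟨h1, h2⟩ := chart_volume j b e
  have hR := det_coordMatrix_ne_zero b e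
  have h3 : fsDensity b e j = fun z => (stdWedge {i : Fin r // i ≠ j} / (r - 1).factorial
      * ‖(coordMatrix b e).det‖ ^ 2) * (rowNormSq (coordMatrix b e) (affineVec j z) ^ r)⁻¹ := by
    funext z
    rw [fsDensity]
    ring
  have hpos : ∀ z, 0 < (rowNormSq (coordMatrix b e) (affineVec j z) ^ r)⁻¹ := fun z => by
    have := rowNormSq_pos hR (affineVec_ne_zero z)
    positivity
  refine ⟨h3 ▸ h1.const_mul _, ?_⟩
  rw [h3]
  simp only [norm_mul, Real.norm_of_nonneg (hpos _).le]
  rw [integral_const_mul, h2, Real.norm_eq_abs, abs_div, Real.norm_of_nonneg (sq_nonneg _),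
    Nat.abs_cast]
  have := norm_pos_iff.2 hR
  field_simp

theorem fsIntegrand_symInner (b e : Module.Basis (Fin r) ℂ V) {h : InnerProductSpace.Core ℂ V}
    (he : ∀ v : V, ∑ j, herm h v (e j) • e j = v) (j : Fin r) (v w : SymPow d V)
    (z : {i : Fin r // i ≠ j} → ℂ) :
    fsIntegrand h b (hatPow (symInner d h) v w) j z
      = ((stdWedge {i : Fin r // i ≠ j} / (r - 1).factorial * ‖(coordMatrix b e).det‖ ^ 2 : ℝ) : ℂ)
        * (powPairing b v w (affineVec j z)
          * (((rowNormSq (coordMatrix b e) (affineVec j z) ^ (r + d))⁻¹ : ℝ) : ℂ)) := by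
  rw [fsIntegrand_eq b e he, hatPow_chart, dualNorm_symInner_powFunctional,
    dualNorm_coordFunctional b he]
  push_cast
  rw [pow_add, mul_inv]
  ring

/-- The integral of the pairing with respect to `Sym^d h`. -/
theorem fsIntegrand_symInner_integral (b : Module.Basis (Fin r) ℂ V)
    (h : InnerProductSpace.Core ℂ V) (j : Fin r) (v w : SymPow d V) :
    Integrable (fsIntegrand h b (hatPow (symInner d h) v w) j) ∧
      ∫ z, fsIntegrand h b (hatPow (symInner d h) v w) j z
        = ((stdWedge {i : Fin r // i ≠ j} / (r - 1).factorial * (Real.pi ^ r * d.factorial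
            / (Real.pi * (r + d - 1).factorial)) : ℝ) : ℂ) * herm (symInner d h) v w := by
  obtain ⟨e, he, hon⟩ := exists_basis_expansion b h
  obtain ⟨h1, h2⟩ := chart_powPairing j b e he hon v w
  have h3 := fsIntegrand_symInner b e he j v w
  refine ⟨funext h3 ▸ h1.const_mul _, ?_⟩
  simp only [h3]
  rw [integral_const_mul, h2, ← mul_assoc, ← Complex.ofReal_mul]
  congr 2
  have := norm_pos_iff.2 (det_coordMatrix_ne_zero b e)
  field_simp

theorem integrable_fsIntegrand_hatPow (b : Module.Basis (Fin r) ℂ V)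
    (h : InnerProductSpace.Core ℂ V) (H : InnerProductSpace.Core ℂ (SymPow d V)) (j : Fin r)
    (v w : SymPow d V) : Integrable (fsIntegrand h b (hatPow H v w) j) := by
  obtain ⟨e, he, -⟩ := exists_basis_expansion b h
  have h1 : fsIntegrand h b (hatPow H v w) j
      = fun z => hatPow H v w (chart b j z) * (fsDensity b e j z : ℂ) :=
    funext (fsIntegrand_eq b e he _ j)
  rw [h1]
  exact (integrable_fsDensity b e j).1.ofReal.bdd_mul
    (measurable_hatPow_chart H h b j v w).aestronglyMeasurable
    (Filter.Eventually.of_forall fun z => norm_hatPow_chart_le H b j v w z)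

theorem norm_integral_hatPow_sub_le (b : Module.Basis (Fin r) ℂ V)
    (h : InnerProductSpace.Core ℂ V) (H S : InnerProductSpace.Core ℂ (SymPow d V))
    (hδ : hermDist H S < 1) (j : Fin r) (v w : SymPow d V) :
    ‖(∫ z, fsIntegrand h b (hatPow H v w) j z) - ∫ z, fsIntegrand h b (hatPow S v w) j z‖
      ≤ hermDist H S * (hermNorm S v * hermNorm S w)
        * (|stdWedge {i : Fin r // i ≠ j}| / (r - 1).factorial
          * (Real.pi ^ r / (Real.pi * (r - 1).factorial))) := by
  obtain ⟨e, he, -⟩ := exists_basis_expansion b h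
  obtain ⟨hi, hv⟩ := integrable_fsDensity b e j
  rw [← integral_sub (integrable_fsIntegrand_hatPow b h H j v w)
    (integrable_fsIntegrand_hatPow b h S j v w), ← hv, ← integral_const_mul]
  refine norm_integral_le_of_norm_le (hi.norm.const_mul _) (Filter.Eventually.of_forall fun z => ?_)
  have h1 : ∀ F, fsIntegrand h b F j z = F (chart b j z) * (fsDensity b e j z : ℂ) := fun F =>
    fsIntegrand_eq b e he F j z
  rw [h1, h1, ← sub_mul, norm_mul, Complex.norm_real]
  exact mul_le_mul_of_nonneg_right (norm_hatPow_chart_sub_le H S hδ b j v w z) (norm_nonneg _)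

end Estimates

/-- For `δ < 1/2` one has `|u|_H² ≥ |u|_S² / 2`, so each factor costs `√2`. -/
theorem hermNorm_mul_le_two_mul {W : Type*} [AddCommGroup W] [Module ℂ W] [FiniteDimensional ℂ W]
    {H S : InnerProductSpace.Core ℂ W} (hδ : hermDist H S < 1 / 2) (v w : W) :
    hermNorm S v * hermNorm S w ≤ 2 * (hermNorm H v * hermNorm H w) := by
  have key : ∀ u, hermNorm S u ≤ Real.sqrt 2 * hermNorm H u := fun u => by
    refine le_sqrt_mul zero_le_two (hermNorm_nonneg H u) ?_
    have := (abs_le.1 (abs_hermNorm_sq_sub_le H S u)).1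
    nlinarith [sq_nonneg (hermNorm S u)]
  calc _ ≤ (Real.sqrt 2 * hermNorm H v) * (Real.sqrt 2 * hermNorm H w) :=
        mul_le_mul (key v) (key w) (hermNorm_nonneg S w)
          (mul_nonneg (Real.sqrt_nonneg _) (hermNorm_nonneg H v))
    _ = (Real.sqrt 2 * Real.sqrt 2) * (hermNorm H v * hermNorm H w) := by ring
    _ = _ := by rw [Real.mul_self_sqrt zero_le_two]

end

/-! ### Assembling the identity and the estimate -/

theorem proposition2p6 (r d : ℕ) (hr : 1 ≤ r) (hd : 1 ≤ d) :
    ∃ Crd C : ℝ,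
      ∀ (V : Type*) [AddCommGroup V] [Module ℂ V] [FiniteDimensional ℂ V]
        (b : Module.Basis (Fin r) ℂ V) (h : InnerProductSpace.Core ℂ V),
        -- `Crd` is the constant `C_{r,d}`, defined by this identity
        (∀ v w : SymPow d V,
          FSIntegrable h b (hatPow (symInner d h) v w) ∧
          (d : ℂ) ^ (r - 1) * fsIntegral h b (hatPow (symInner d h) v w)
            = (Crd : ℂ) * herm (symInner d h) v w) ∧
        -- the estimate
        (∀ (H : InnerProductSpace.Core ℂ (SymPow d V)) (ε : ℝ),
          hermDist H (symInner d h) < min ε (1 / 2) →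
          ∀ v w : SymPow d V,
            FSIntegrable h b (hatPow H v w) ∧
            ‖(d : ℂ) ^ (r - 1) * fsIntegral h b (hatPow H v w) - (Crd : ℂ) * herm H v w‖
              ≤ C * ε * hermNorm H v * hermNorm H w) := by
  set j₀ : Fin r := ⟨0, hr⟩
  have h0 : ∀ j, j₀ ≤ j := fun j => Nat.zero_le _
  set c : ℝ := stdWedge {i : Fin r // i ≠ j₀} / (r - 1).factorial * (Real.pi ^ r * d.factorial
    / (Real.pi * (r + d - 1).factorial)) with hc
  set vol : ℝ := |stdWedge {i : Fin r // i ≠ j₀}| / (r - 1).factorial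
    * (Real.pi ^ r / (Real.pi * (r - 1).factorial)) with hvol
  have hvol0 : 0 ≤ vol := by have := Real.pi_pos; positivity
  -- The two summands of `C` bound the change of the integral and the change of `C_{r,d} ⟨v, w⟩`;
  -- the factor `2` is the cost of passing from `S`-norms to `H`-norms.
  refine ⟨d ^ (r - 1) * c, 2 * (d ^ (r - 1) * vol + |d ^ (r - 1) * c|), ?_⟩
  intro V _ _ _ b h
  have hS : ∀ v w : SymPow d V,
      (d : ℂ) ^ (r - 1) * fsIntegral h b (hatPow (symInner d h) v w)
        = ((d ^ (r - 1) * c : ℝ) : ℂ) * herm (symInner d h) v w := by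
    intro v w
    rw [fsIntegral_eq h b _ h0, (fsIntegrand_symInner_integral b h j₀ v w).2, ← hc]
    push_cast
    ring
  refine ⟨fun v w => ⟨(fsIntegrable_iff h b _ h0).2 (integrable_fsIntegrand_hatPow b h _ j₀ v w),
    hS v w⟩, fun H ε hε v w =>
    ⟨(fsIntegrable_iff h b _ h0).2 (integrable_fsIntegrand_hatPow b h H j₀ v w), ?_⟩⟩
  set S := symInner d h
  obtain ⟨hε1, hε2⟩ := lt_min_iff.1 hε
  have hδ0 := hermDist_nonneg H S
  have h1 := norm_integral_hatPow_sub_le b h H S (hε2.trans (by norm_num)) j₀ v w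
  rw [← hvol, ← fsIntegral_eq h b _ h0, ← fsIntegral_eq h b _ h0] at h1
  have h2 := norm_herm_sub_le H S v w
  have h3 := hermNorm_mul_le_two_mul hε2 v w
  have hN : 0 ≤ hermNorm H v * hermNorm H w :=
    mul_nonneg (hermNorm_nonneg H v) (hermNorm_nonneg H w)
  have h4 : hermDist H S * (hermNorm S v * hermNorm S w)
      ≤ ε * (2 * (hermNorm H v * hermNorm H w)) :=
    mul_le_mul hε1.le h3 (mul_nonneg (hermNorm_nonneg S v) (hermNorm_nonneg S w))
      (hδ0.trans hε1.le)
  -- Subtracting the exact identity for `S` leaves only differences between `H` and `S`.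
  have h5 : (d : ℂ) ^ (r - 1) * fsIntegral h b (hatPow H v w)
        - ((d ^ (r - 1) * c : ℝ) : ℂ) * herm H v w
      = (d : ℂ) ^ (r - 1) * (fsIntegral h b (hatPow H v w) - fsIntegral h b (hatPow S v w))
        - ((d ^ (r - 1) * c : ℝ) : ℂ) * (herm H v w - herm S v w) := by
    linear_combination hS v w
  rw [h5]
  refine (norm_sub_le _ _).trans ?_
  rw [norm_mul, norm_mul, norm_pow, Complex.norm_natCast, Complex.norm_real, Real.norm_eq_abs]
  calc _ ≤ (d : ℝ) ^ (r - 1) * (ε * (2 * (hermNorm H v * hermNorm H w)) * vol)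
        + |(d : ℝ) ^ (r - 1) * c| * (ε * (2 * (hermNorm H v * hermNorm H w))) := by
        refine add_le_add (mul_le_mul_of_nonneg_left ?_ (by positivity))
          (mul_le_mul_of_nonneg_left ?_ (abs_nonneg _))
        · exact h1.trans (mul_le_mul_of_nonneg_right h4 hvol0)
        · exact h2.trans (by rw [mul_assoc]; exact h4)
    _ = _ := by ring
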